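/- **Setting.** Let $\Lambda\subset\mathbb R^d$ be compact. A curve in $\Lambda$ is given by a continuous function $f:[0,1]\to\Lambda$; the distance of the curves given by $f_1,f_2$ is $\inf_{\phi_1,\phi_2}\sup_t|f_1(\phi_1(t))-f_2(\phi_2(t))|$, the infimum being over strictly monotone continuous maps of $[0,1]$ onto itself, and functions at distance $0$ are identified (they are parametrizations of the same curve). Let $\Omega_\Lambda$ be the space of closed sets $\mathcal F$ of curves in $\Lambda$, with the Hausdorff metric and its Borel $\sigma$-algebra. A system of random curves in $\Lambda$ with short-distance cutoff is a family of Borel probability measures $(\mu_\delta)_{0<\delta\le\delta_{\max}}$ on $\Omega_\Lambda$, $0<\delta_{\max}\le 1$, for which there is $N<\infty$ such that for all $\delta$ and $\mu_\delta$-almost every $\mathcal F$, every $\mathcal C\in\mathcal F$ is a polygonal path with steps of length at most $\delta$, of which at most $N$ vertices (counted with multiplicity along the path) lie in any closed ball of radius $\delta$. Random variables $X_\delta$ are stochastically bounded as $\delta\to0$ if for every $\eta>0$ there is $u<\infty$ with $\mu_\delta(|X_\delta|\ge u)\le\eta$ for all $\delta\in(0,\delta_{\max}]$. **Hypothesis H1.**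 There are constants $K_k<\infty$ and exponents $\lambda(k)$ with $\lambda(k)\to\infty$ as $k\to\infty$, such that for all $k\ge1$, all $\delta\in(0,\delta_{\max}]$, all $x\in\mathbb R^d$ and all $\delta\le r<R\le1$, the $\mu_\delta$-probability that the shell $D(x;r,R)=\{y: r\le|y-x|\le R\}$ is traversed by $k$ separate segments of some curve $\mathcal C\in\mathcal F$ is at most $K_k\,(r/R)^{\lambda(k)}$. **Theorem (Regularity).** Let $(\mu_\delta)$ be a system of random curves in a compact $\Lambda\subset\mathbb R^d$ satisfying H1, with $0\le\lambda(1)<d$. Then for every $\varepsilon>0$ with $d-\lambda(1)+\varepsilon\ge1$ (that is, for every $\varepsilon>0$ if $\lambda(1)\le d-1$) there are random variables $\kappa_{\varepsilon;\delta}$ on $\Omega_\Lambda$, stochastically bounded as $\delta\to0$, such that for every $\delta\in(0,\delta_{\max}]$ and $\mu_\delta$-almost every $\mathcal F$, every curve $\mathcal C\in\mathcal F$ has a parametrization $\gamma:[0,1]\to\Lambda$ with $$|\gamma(t_1)-\gamma(t_2)|\ \le\ \kappa_{\varepsilon;\delta}(\mathcal F)\; g(\operatorname{diam}\mathcal C)^{1+\varepsilon}\;|t_1-t_2|^{\frac1{d-\lambda(1)+\varepsilon}}\qquad\text{for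 all }0\le t_1<t_2\le1,$$ where $g(r)=r^{-\lambda(1)/(d-\lambda(1))}$. -/

import Mathlib

open Set Filter Topology MeasureTheory TopologicalSpace
open scoped unitInterval ENNReal

namespace RandomCurves

noncomputable section

/-! ### The space of curves -/

/-- A parametrized curve in `X`: a continuous function `[0,1] → X`. -/
structure ParamCurve (X : Type*) [TopologicalSpace X] where
  toMap : C(I, X)

/-- The reparametrization `γ ∘ φ` by a homeomorphism `φ` of `[0,1]`, that is, by a strictly
monotone (increasing or decreasing) continuous map of `[0,1]` onto itself. -/
def ParamCurve.reparam {X : Type*} [TopologicalSpace X] (γ : ParamCurve X) (φ : I ≃ₜ I) :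
    C(I, X) :=
  γ.toMap.comp (φ : C(I, I))

/-- The distance between two curves given by parametrizations `f₁`, `f₂`:
`inf_{φ₁, φ₂} sup_t |f₁ (φ₁ t) - f₂ (φ₂ t)|`, the infimum being over all strictly monotone
continuous maps `φ₁`, `φ₂` of `[0,1]` onto itself (`dist` on `C(I, X)` is the sup distance). -/
def curveDist {X : Type*} [PseudoMetricSpace X] (f₁ f₂ : ParamCurve X) : ℝ :=
  ⨅ φ : (I ≃ₜ I) × (I ≃ₜ I), dist (f₁.reparam φ.1) (f₂.reparam φ.2)

section DistFacts

variable {X : Type*} [PseudoMetricSpace X]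

theorem curveDist_bddBelow (f g : ParamCurve X) :
    BddBelow (range fun φ : (I ≃ₜ I) × (I ≃ₜ I) => dist (f.reparam φ.1) (g.reparam φ.2)) :=
  ⟨0, by rintro _ ⟨φ, rfl⟩; exact dist_nonneg⟩

theorem curveDist_le (f g : ParamCurve X) (φ ψ : I ≃ₜ I) :
    curveDist f g ≤ dist (f.reparam φ) (g.reparam ψ) :=
  ciInf_le (curveDist_bddBelow f g) (φ, ψ)

theorem curveDist_nonneg (f g : ParamCurve X) : 0 ≤ curveDist f g :=
  Real.iInf_nonneg fun _ => dist_nonneg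

theorem curveDist_self (f : ParamCurve X) : curveDist f f = 0 :=
  le_antisymm (by simpa using curveDist_le f f (Homeomorph.refl I) (Homeomorph.refl I))
    (curveDist_nonneg f f)

theorem curveDist_comm (f g : ParamCurve X) : curveDist f g = curveDist g f := by
  have key : ∀ f g : ParamCurve X, curveDist f g ≤ curveDist g f := fun f g =>
    le_ciInf fun φ => by rw [dist_comm]; exact curveDist_le f g φ.2 φ.1
  exact le_antisymm (key f g) (key g f)

theorem dist_reparam_trans (f g : ParamCurve X) (φ ψ χ : I ≃ₜ I) :
    dist (f.reparam (χ.trans φ)) (g.reparam (χ.trans ψ)) ≤ dist (f.reparam φ) (g.reparam ψ) :=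
  (ContinuousMap.dist_le dist_nonneg).2 fun t =>
    ContinuousMap.dist_apply_le_dist (f := f.reparam φ) (g := g.reparam ψ) (χ t)

theorem curveDist_triangle (f g h : ParamCurve X) :
    curveDist f h ≤ curveDist f g + curveDist g h := by
  refine le_of_forall_pos_le_add fun η hη => ?_
  obtain ⟨⟨φ₁, φ₂⟩, h₁⟩ := exists_lt_of_ciInf_lt
    (show curveDist f g < curveDist f g + η / 2 by linarith)
  obtain ⟨⟨ψ₁, ψ₂⟩, h₂⟩ := exists_lt_of_ciInf_lt
    (show curveDist g h < curveDist g h + η / 2 by linarith)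
  have e₁ := dist_reparam_trans f g φ₁ φ₂ φ₂.symm
  have e₂ := dist_reparam_trans g h ψ₁ ψ₂ ψ₁.symm
  rw [Homeomorph.symm_trans_self] at e₁ e₂
  have e₃ := dist_triangle (f.reparam (φ₂.symm.trans φ₁)) (g.reparam (Homeomorph.refl I))
    (h.reparam (ψ₁.symm.trans ψ₂))
  have e₄ := curveDist_le f h (φ₂.symm.trans φ₁) (ψ₁.symm.trans ψ₂)
  dsimp only at h₁ h₂
  linarith

end DistFacts

instance {X : Type*} [PseudoMetricSpace X] : PseudoMetricSpace (ParamCurve X) where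
  dist := curveDist
  dist_self := curveDist_self
  dist_comm := curveDist_comm
  dist_triangle := curveDist_triangle

/-- The metric space `S_X` of curves in `X`: continuous functions `[0,1] → X`, two of them being
the same curve if their distance `curveDist` vanishes. (Among functions which are not constant on
any interval this means that they agree after reparametrizing both by homeomorphisms of `[0,1]`.) -/
abbrev Curve (X : Type*) [PseudoMetricSpace X] := SeparationQuotient (ParamCurve X)

/-- `γ` is a parametrization of the curve `C`. -/
def Parametrizes {X : Type*} [PseudoMetricSpace X] (γ : ParamCurve X) (C : Curve X) : Prop :=
  SeparationQuotient.mk γ = C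

/-- The space `Ω_X` of configurations: closed sets of curves in `X`, with the (extended) Hausdorff
metric. -/
abbrev Config (X : Type*) [PseudoMetricSpace X] := Closeds (Curve X)

instance {X : Type*} [PseudoMetricSpace X] : MeasurableSpace (Config X) := borel _

instance {X : Type*} [PseudoMetricSpace X] : BorelSpace (Config X) := ⟨rfl⟩

/-! ### Polygonal paths and crossings of shells -/

/-- `C` is a polygonal path of step size `δ`, with local complexity at most `N`: it can be
parametrized by running linearly, in time `1 / n` for each step, through points `v 0, …, v n` of
`ℝ^d`, consecutive ones being at distance at most `δ`, such that any closed ball of radius `δ`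
contains at most `N` of these points (counted with multiplicity). -/
def IsPolygonal {d : ℕ} {Λ : Set (EuclideanSpace ℝ (Fin d))} (δ : ℝ) (N : ℕ) (C : Curve Λ) :
    Prop :=
  ∃ (γ : ParamCurve Λ) (n : ℕ) (v : ℕ → EuclideanSpace ℝ (Fin d)),
    Parametrizes γ C ∧ 1 ≤ n ∧
    (∀ i < n, dist (v i) (v (i + 1)) ≤ δ) ∧
    (∀ i < n, ∀ t : I, ∀ θ ∈ Icc (0 : ℝ) 1, (n : ℝ) * t = i + θ →
      (γ.toMap t : EuclideanSpace ℝ (Fin d)) = AffineMap.lineMap (v i) (v (i + 1)) θ) ∧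
    ∀ x : EuclideanSpace ℝ (Fin d),
      {i : ℕ | i ≤ n ∧ dist (v i) x ≤ δ}.ncard ≤ N

/-- The shell `D(x; r, R) = {y | r ≤ |y - x| ≤ R}` is traversed by `k` separate segments of the
curve `C`: there are `k` non-overlapping time intervals `[s i, t i]` such that over each of them
the curve gets from the inner ball `|y - x| ≤ r` to the outer region `|y - x| ≥ R`, or back. -/
def Traversed {d : ℕ} {Λ : Set (EuclideanSpace ℝ (Fin d))} (C : Curve Λ) (k : ℕ)
    (x : EuclideanSpace ℝ (Fin d)) (r R : ℝ) : Prop :=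
  ∃ γ : ParamCurve Λ, Parametrizes γ C ∧ ∃ s t : Fin k → I,
    (∀ i, s i ≤ t i) ∧ (∀ i j, i < j → t i ≤ s j) ∧
    ∀ i, (dist (γ.toMap (s i) : EuclideanSpace ℝ (Fin d)) x ≤ r ∧
            R ≤ dist (γ.toMap (t i) : EuclideanSpace ℝ (Fin d)) x) ∨
         (R ≤ dist (γ.toMap (s i) : EuclideanSpace ℝ (Fin d)) x ∧
            dist (γ.toMap (t i) : EuclideanSpace ℝ (Fin d)) x ≤ r)

/-! ### Systems of random curves -/

/-- A system of random curves in `Λ` with short-distance cutoff `δ ∈ (0, δmax]`: for each `δ` a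
probability measure `μ δ` on configurations, almost surely consisting of polygonal paths of step
size `δ` whose local complexity is bounded uniformly (in the path, in `ω` and in `δ`). -/
def IsSystem {d : ℕ} {Λ : Set (EuclideanSpace ℝ (Fin d))} (δmax : ℝ)
    (μ : ℝ → Measure (Config Λ)) : Prop :=
  (∀ δ ∈ Ioc 0 δmax, IsProbabilityMeasure (μ δ)) ∧
  ∃ N : ℕ, ∀ δ ∈ Ioc 0 δmax, ∀ᵐ F ∂(μ δ), ∀ C ∈ F, IsPolygonal δ N C

/-- The hypothesis **H1**, the power bound on the probability of multiple crossings, with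
constants `K k` and exponents `lam k → ∞`. -/
def HypothesisH1 {d : ℕ} {Λ : Set (EuclideanSpace ℝ (Fin d))} (δmax : ℝ)
    (μ : ℝ → Measure (Config Λ)) (K lam : ℕ → ℝ) : Prop :=
  (∀ k : ℕ, 1 ≤ k → ∀ δ ∈ Ioc 0 δmax, ∀ (x : EuclideanSpace ℝ (Fin d)) (r R : ℝ),
    δ ≤ r → r < R → R ≤ 1 →
      μ δ {F | ∃ C ∈ F, Traversed C k x r R} ≤ ENNReal.ofReal (K k * (r / R) ^ lam k)) ∧
  Tendsto lam atTop atTop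

/-- The random variables `X δ` stay stochastically bounded as `δ → 0`. -/
def StochasticallyBounded {Ω : Type*} [MeasurableSpace Ω] (δmax : ℝ) (μ : ℝ → Measure Ω)
    (X : ℝ → Ω → ℝ) : Prop :=
  ∀ η : ℝ, 0 < η → ∃ u : ℝ, ∀ δ ∈ Ioc 0 δmax, μ δ {ω | u ≤ |X δ ω|} ≤ ENNReal.ofReal η

end

end RandomCurves

open RandomCurves

/-!
The regularity of a polygonal curve at scale `r` is measured by its tortuosity, the number of pieces
of diameter about `r` into which it has to be cut.

A union bound over the dyadic scales `ℓ` and over an `ℓ`-net of `Λ`, with H1 for `k = 1` and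
Markov's inequality, shows that the number of net points from which some curve crosses from distance
`ℓ` to distance `R` is at most of order `ℓ ^ (-a) R ^ (-λ(1))`, where `a` is any number larger than
`d - λ(1)`. For `α < 1` and `k` so large that `(1 - α) λ(k) > d`, the same argument excludes, at
small scales, `k`-fold crossings from `ℓ` to `ℓ ^ α`. Hence a curve of diameter at least `4 R`, when
cut greedily into pieces of size `r = 2 ℓ ^ α`, is cut at most `k` times near each of those net
points, and its tortuosity is of order `r ^ (-a / α) R ^ (-λ(1))`. Here `a / α` may be taken smaller
than `s = d - λ(1) + ε`.

If each cut of scale `r` receives an amount of time proportional to `r ^ s`, the total time over all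
dyadic scales is finite, and the resulting parametrization is Hölder continuous of order `1 / s`.
The power of the diameter comes from taking `R` proportional to it.
-/

namespace RandomCurves

/-! ### Dyadic scales -/

/-- The dyadic multiples `δ, 2 δ, 4 δ, …` of `δ > 0` which do not exceed `ℓ₀`: the scales at which
curves with short-distance cutoff `δ` are examined. -/
noncomputable def dyadicScales (δ ℓ₀ : ℝ) : Finset ℝ :=
  ((Finset.range (⌊ℓ₀ / δ⌋₊ + 1)).image fun i => δ * 2 ^ i).filter (· ≤ ℓ₀)

section DyadicScales

variable {δ ℓ₀ ℓ : ℝ}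

theorem mem_dyadicScales (hδ : 0 < δ) :
    ℓ ∈ dyadicScales δ ℓ₀ ↔ (∃ i : ℕ, δ * 2 ^ i = ℓ) ∧ ℓ ≤ ℓ₀ := by
  simp only [dyadicScales, Finset.mem_filter, Finset.mem_image, Finset.mem_range]
  refine and_congr_left fun hℓ => exists_congr fun i => and_iff_right_of_imp ?_
  rintro rfl
  have hi : (i : ℝ) ≤ ℓ₀ / δ := by
    rw [le_div_iff₀' hδ]
    refine le_trans (mul_le_mul_of_nonneg_left ?_ hδ.le) hℓ
    exact_mod_cast i.lt_two_pow_self.le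
  exact Nat.lt_succ_of_le (Nat.le_floor hi)

theorem le_of_mem_dyadicScales (h : ℓ ∈ dyadicScales δ ℓ₀) : ℓ ≤ ℓ₀ :=
  (Finset.mem_filter.1 h).2

theorem cutoff_le_of_mem_dyadicScales (hδ : 0 < δ) (h : ℓ ∈ dyadicScales δ ℓ₀) : δ ≤ ℓ := by
  obtain ⟨⟨i, rfl⟩, -⟩ := (mem_dyadicScales hδ).1 h
  exact le_mul_of_one_le_right hδ.le (one_le_pow₀ one_le_two)

theorem pos_of_mem_dyadicScales (hδ : 0 < δ) (h : ℓ ∈ dyadicScales δ ℓ₀) : 0 < ℓ :=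
  hδ.trans_le (cutoff_le_of_mem_dyadicScales hδ h)

theorem exists_mem_dyadicScales (hδ : 0 < δ) {x : ℝ} (hδx : δ ≤ x) (hx : x ≤ ℓ₀) :
    ∃ ℓ ∈ dyadicScales δ ℓ₀, ℓ ≤ x ∧ x < 2 * ℓ := by
  obtain ⟨i, h1, h2⟩ := exists_nat_pow_near ((one_le_div hδ).2 hδx) one_lt_two
  rw [le_div_iff₀' hδ] at h1
  rw [div_lt_iff₀' hδ, pow_succ'] at h2
  exact ⟨δ * 2 ^ i, (mem_dyadicScales hδ).2 ⟨⟨i, rfl⟩, h1.trans hx⟩, h1, by linarith⟩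

theorem exists_mem_dyadicScales_lt_le (hδ : 0 < δ) {c x : ℝ} (hc : 5 ≤ c) (hδx : 2 * c * δ < x)
    (hx : x ≤ c * ℓ₀) : ∃ ℓ ∈ dyadicScales δ ℓ₀, 4 * ℓ < x ∧ x ≤ 2 * c * ℓ := by
  obtain ⟨ℓ, hℓ, hle, hlt⟩ := exists_mem_dyadicScales (ℓ₀ := ℓ₀) hδ
    (le_min (by nlinarith) (by nlinarith) : δ ≤ min (x / 5) ℓ₀) (min_le_right _ _)
  have := pos_of_mem_dyadicScales hδ hℓ
  refine ⟨ℓ, hℓ, by linarith [hle.trans (min_le_left _ _)], ?_⟩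
  rcases min_lt_iff.1 hlt with h | h <;> nlinarith

theorem one_sub_two_rpow_neg_pos {ε : ℝ} (hε : 0 < ε) : 0 < 1 - (2 : ℝ) ^ (-ε) :=
  sub_pos.2 (Real.rpow_lt_one_of_one_lt_of_neg one_lt_two (neg_lt_zero.2 hε))

theorem sum_range_dyadic_rpow_le (hδ : 0 < δ) {ε : ℝ} (hε : 0 < ε) (M : ℕ) :
    ∑ i ∈ Finset.range (M + 1), (δ * 2 ^ i) ^ ε ≤ (δ * 2 ^ M) ^ ε / (1 - 2 ^ (-ε)) := by
  have hq := one_sub_two_rpow_neg_pos hε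
  have htele (i : ℕ) : (δ * 2 ^ i) ^ ε * (1 - 2 ^ (-ε)) =
      (δ * 2 ^ (i + 1) / 2) ^ ε - (δ * 2 ^ i / 2) ^ ε := by
    rw [Real.div_rpow (by positivity) zero_le_two (x := δ * 2 ^ i), pow_succ, ← mul_assoc,
      mul_div_cancel_right₀ _ two_ne_zero, Real.rpow_neg zero_le_two]
    ring
  rw [le_div_iff₀ hq, Finset.sum_mul, Finset.sum_congr rfl fun i _ => htele i,
    Finset.sum_range_sub fun i : ℕ => (δ * 2 ^ i / 2) ^ ε, pow_succ, ← mul_assoc,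
    mul_div_cancel_right₀ _ two_ne_zero]
  exact sub_le_self _ (by positivity)

theorem sum_dyadicScales_rpow_le (hδ : 0 < δ) (hℓ₀ : 0 ≤ ℓ₀) {ε : ℝ} (hε : 0 < ε) :
    ∑ ℓ ∈ dyadicScales δ ℓ₀, ℓ ^ ε ≤ ℓ₀ ^ ε / (1 - 2 ^ (-ε)) := by
  have hq := one_sub_two_rpow_neg_pos hε
  rcases (dyadicScales δ ℓ₀).eq_empty_or_nonempty with h | h
  · rw [h, Finset.sum_empty]
    positivity
  · obtain ⟨⟨M, hM⟩, hMℓ₀⟩ := (mem_dyadicScales hδ).1 (Finset.max'_mem _ h)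
    have hsub : dyadicScales δ ℓ₀ ⊆ (Finset.range (M + 1)).image fun i => δ * 2 ^ i := by
      intro ℓ hℓ
      obtain ⟨⟨i, rfl⟩, -⟩ := (mem_dyadicScales hδ).1 hℓ
      have hi := Finset.le_max' _ _ hℓ
      rw [← hM, mul_le_mul_iff_right₀ hδ, pow_le_pow_iff_right₀ one_lt_two] at hi
      exact Finset.mem_image_of_mem _ (Finset.mem_range_succ_iff.2 hi)
    have hinj : Function.Injective fun i : ℕ => δ * 2 ^ i := fun i j hij =>
      pow_right_injective₀ two_pos (by norm_num) (mul_left_cancel₀ hδ.ne' hij)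
    calc ∑ ℓ ∈ dyadicScales δ ℓ₀, ℓ ^ ε
        ≤ ∑ ℓ ∈ (Finset.range (M + 1)).image fun i => δ * 2 ^ i, ℓ ^ ε :=
          Finset.sum_le_sum_of_subset_of_nonneg hsub fun ℓ hℓ _ => by
            obtain ⟨i, -, rfl⟩ := Finset.mem_image.1 hℓ
            positivity
      _ = ∑ i ∈ Finset.range (M + 1), (δ * 2 ^ i) ^ ε := Finset.sum_image hinj.injOn
      _ ≤ (δ * 2 ^ M) ^ ε / (1 - 2 ^ (-ε)) := sum_range_dyadic_rpow_le hδ hε M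
      _ ≤ ℓ₀ ^ ε / (1 - 2 ^ (-ε)) := by
          gcongr
          exact hM ▸ hMℓ₀

theorem measure_biUnion_dyadicScales_le {Ω : Type*} [MeasurableSpace Ω] {ν : Measure Ω}
    {A : ℝ → Set Ω} (hδ : 0 < δ) (hℓ₀ : 0 ≤ ℓ₀) {c ε : ℝ} (hc : 0 ≤ c) (hε : 0 < ε)
    (h : ∀ ℓ ∈ dyadicScales δ ℓ₀, ν (A ℓ) ≤ ENNReal.ofReal (c * ℓ ^ ε)) :
    ν (⋃ ℓ ∈ dyadicScales δ ℓ₀, A ℓ) ≤ ENNReal.ofReal (c * (ℓ₀ ^ ε / (1 - 2 ^ (-ε)))) :=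
  calc ν (⋃ ℓ ∈ dyadicScales δ ℓ₀, A ℓ)
      ≤ ∑ ℓ ∈ dyadicScales δ ℓ₀, ν (A ℓ) := measure_biUnion_finset_le _ _
    _ ≤ ∑ ℓ ∈ dyadicScales δ ℓ₀, ENNReal.ofReal (c * ℓ ^ ε) := Finset.sum_le_sum h
    _ = ENNReal.ofReal (c * ∑ ℓ ∈ dyadicScales δ ℓ₀, ℓ ^ ε) := by
      rw [Finset.mul_sum, ENNReal.ofReal_sum_of_nonneg fun ℓ hℓ =>
        mul_nonneg hc (Real.rpow_nonneg (pos_of_mem_dyadicScales hδ hℓ).le ε)]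
    _ ≤ ENNReal.ofReal (c * (ℓ₀ ^ ε / (1 - 2 ^ (-ε)))) :=
      ENNReal.ofReal_le_ofReal
        (mul_le_mul_of_nonneg_left (sum_dyadicScales_rpow_le hδ hℓ₀ hε) hc)

end DyadicScales

/-! ### Cutting a sequence into pieces of small diameter -/

section Cuts

variable {X : Type*} [PseudoMetricSpace X]

/-- Starting point of the piece containing the index `j`, when the sequence `v` is divided greedily:
a new piece is begun as soon as the sequence leaves the closed ball of radius `r` about the starting
point of the current piece. -/
noncomputable def lastCut (v : ℕ → X) (r : ℝ) : ℕ → ℕ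
  | 0 => 0
  | j + 1 => open Classical in
      if r < dist (v (j + 1)) (v (lastCut v r j)) then j + 1 else lastCut v r j

/-- The steps `j → j + 1 ≤ n` at which a new piece is begun. Their number, the tortuosity of the
sequence at scale `r`, is within a factor of two of the least number of pieces of diameter `r`. -/
noncomputable def cuts (v : ℕ → X) (r : ℝ) (n : ℕ) : Finset ℕ := open Classical in
  (Finset.range n).filter fun j => r < dist (v (j + 1)) (v (lastCut v r j))

theorem mem_cuts {v : ℕ → X} {r : ℝ} {n j : ℕ} :
    j ∈ cuts v r n ↔ j < n ∧ r < dist (v (j + 1)) (v (lastCut v r j)) := by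
  simp only [cuts, Finset.mem_filter, Finset.mem_range]

theorem lastCut_le (v : ℕ → X) (r : ℝ) (j : ℕ) : lastCut v r j ≤ j := by
  induction j with
  | zero => exact le_rfl
  | succ j ih =>
    rw [lastCut]
    split_ifs
    exacts [le_rfl, ih.trans j.le_succ]

theorem dist_lastCut_le (v : ℕ → X) {r : ℝ} (hr : 0 ≤ r) (j : ℕ) :
    dist (v j) (v (lastCut v r j)) ≤ r := by
  cases j with
  | zero => simpa only [lastCut, dist_self] using hr
  | succ j =>
    rw [lastCut]
    split_ifs with h
    · rwa [dist_self]
    · exact not_lt.1 h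

theorem monotone_lastCut (v : ℕ → X) (r : ℝ) : Monotone (lastCut v r) := by
  refine monotone_nat_of_le_succ fun j => ?_
  rw [lastCut]
  split_ifs
  exacts [(lastCut_le v r j).trans j.le_succ, le_rfl]

theorem lt_lastCut_of_mem_cuts {v : ℕ → X} {r : ℝ} {n j j' : ℕ} (hj : j ∈ cuts v r n)
    (h : j < j') : j + 1 ≤ lastCut v r j' := by
  refine le_trans (le_of_eq ?_) (monotone_lastCut v r (show j + 1 ≤ j' from h))
  rw [lastCut, if_pos (mem_cuts.1 hj).2]

theorem exists_mem_cuts (v : ℕ → X) {r : ℝ} (hr : 0 ≤ r) {n i₁ i₂ : ℕ} (h : i₁ ≤ i₂) (hn : i₂ ≤ n)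
    (hd : 2 * r < dist (v i₁) (v i₂)) : ∃ j ∈ cuts v r n, i₁ ≤ j ∧ j < i₂ := by
  by_contra! hcon
  have hconst : ∀ i, i₁ ≤ i → i ≤ i₂ → lastCut v r i = lastCut v r i₁ := by
    intro i hi
    induction i, hi using Nat.le_induction with
    | base => exact fun _ => rfl
    | succ j hj ih =>
      intro hj₂
      rw [lastCut, if_neg, ih (by omega)]
      intro hlt
      have := hcon j (mem_cuts.2 ⟨by omega, hlt⟩) hj
      omega
  have h₁ := dist_lastCut_le v hr i₁
  have h₂ := dist_lastCut_le v hr i₂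
  rw [hconst i₂ h le_rfl] at h₂
  linarith [dist_triangle_right (v i₁) (v i₂) (v (lastCut v r i₁))]

end Cuts

/-! ### Reparametrization of the unit interval -/

theorem exists_orderIso_sub_le {f : I → ℝ} (hf : Continuous f) (hmono : StrictMono f)
    (hf1 : f 1 - f 0 ≤ 1) :
    ∃ ψ : I ≃o I, ∀ t₁ t₂ : I, t₁ ≤ t₂ → f t₂ - f t₁ ≤ (ψ t₂ : ℝ) - ψ t₁ := by
  have hpos : 0 < f 1 - f 0 := sub_pos.2 (hmono zero_lt_one)
  have hmem (t : I) : (f t - f 0) / (f 1 - f 0) ∈ I :=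
    ⟨div_nonneg (sub_nonneg.2 (hmono.monotone unitInterval.nonneg')) hpos.le,
      div_le_one_of_le₀ (sub_le_sub_right (hmono.monotone unitInterval.le_one') _) hpos.le⟩
  let g : I → I := fun t => ⟨(f t - f 0) / (f 1 - f 0), hmem t⟩
  have hg : StrictMono g := fun a b hab =>
    div_lt_div_of_pos_right (sub_lt_sub_right (hmono hab) _) hpos
  have hsurj : Function.Surjective g := fun y =>
    mem_range_of_exists_le_of_exists_ge (((hf.sub continuous_const).div_const _).subtype_mk _)
      ⟨0, Subtype.coe_le_coe.1 (by simpa only [g, sub_self, zero_div] using y.2.1)⟩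
      ⟨1, Subtype.coe_le_coe.1 (by simpa only [g, div_self hpos.ne'] using y.2.2)⟩
  refine ⟨hg.orderIsoOfSurjective g hsurj, fun t₁ t₂ ht => ?_⟩
  change f t₂ - f t₁ ≤ (f t₂ - f 0) / (f 1 - f 0) - (f t₁ - f 0) / (f 1 - f 0)
  rw [← sub_div, sub_sub_sub_cancel_right]
  exact le_div_self (sub_nonneg.2 (hmono.monotone ht)) hpos hf1

/-- The time change which runs at constant rate `n * w j` through each of the `n` intervals
`[j / n, (j + 1) / n]`, in addition to the rate `1 / 2` everywhere. -/
noncomputable def weightedTime (n : ℕ) (w : ℕ → ℝ) (t : ℝ) : ℝ :=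
  t / 2 + ∑ j ∈ Finset.range n, w j * projIcc (0 : ℝ) 1 zero_le_one (n * t - j)

section WeightedTime

variable {n : ℕ} {w : ℕ → ℝ} {t₁ t₂ : ℝ}

theorem continuous_weightedTime (n : ℕ) (w : ℕ → ℝ) : Continuous (weightedTime n w) := by
  unfold weightedTime
  fun_prop

theorem sum_le_weightedTime_sub (hw : ∀ j, 0 ≤ w j) (ht : t₁ ≤ t₂) {J : Finset ℕ}
    (hJ : J ⊆ Finset.range n) :
    (t₂ - t₁) / 2 + ∑ j ∈ J, w j * ((projIcc (0 : ℝ) 1 zero_le_one (n * t₂ - j) : ℝ) -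
      projIcc (0 : ℝ) 1 zero_le_one (n * t₁ - j)) ≤ weightedTime n w t₂ - weightedTime n w t₁ := by
  have hmono (j : ℕ) : (projIcc (0 : ℝ) 1 zero_le_one (n * t₁ - j) : ℝ) ≤
      projIcc (0 : ℝ) 1 zero_le_one (n * t₂ - j) :=
    monotone_projIcc zero_le_one (sub_le_sub_right (mul_le_mul_of_nonneg_left ht n.cast_nonneg) _)
  have hle := Finset.sum_le_sum_of_subset_of_nonneg hJ fun j _ _ =>
    mul_nonneg (hw j) (sub_nonneg.2 (hmono j))
  simp only [mul_sub, Finset.sum_sub_distrib, weightedTime] at hle ⊢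
  linarith

theorem half_sub_le_weightedTime_sub (hw : ∀ j, 0 ≤ w j) (ht : t₁ ≤ t₂) :
    (t₂ - t₁) / 2 ≤ weightedTime n w t₂ - weightedTime n w t₁ := by
  simpa only [Finset.sum_empty, add_zero] using
    sum_le_weightedTime_sub hw ht (Finset.empty_subset (Finset.range n))

theorem strictMono_weightedTime (hw : ∀ j, 0 ≤ w j) : StrictMono (weightedTime n w) :=
  fun _ _ ht => sub_pos.1 <|
    (half_pos (sub_pos.2 ht)).trans_le (half_sub_le_weightedTime_sub hw ht.le)

theorem le_weightedTime_sub (hw : ∀ j, 0 ≤ w j) (ht : t₁ ≤ t₂) {j : ℕ} (hj : j < n)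
    (h₁ : n * t₁ ≤ j) (h₂ : j + 1 ≤ n * t₂) :
    w j ≤ weightedTime n w t₂ - weightedTime n w t₁ := by
  have h := sum_le_weightedTime_sub hw ht
    (Finset.singleton_subset_iff.2 (Finset.mem_range.2 hj))
  rw [Finset.sum_singleton, projIcc_of_right_le zero_le_one (by linarith),
    projIcc_of_le_left zero_le_one (by linarith)] at h
  linarith

theorem weightedTime_one_sub_zero_le (hw : ∀ j, 0 ≤ w j) :
    weightedTime n w 1 - weightedTime n w 0 ≤ 1 / 2 + ∑ j ∈ Finset.range n, w j := by
  have hsum_le : ∑ j ∈ Finset.range n, w j * projIcc (0 : ℝ) 1 zero_le_one (n * 1 - j) ≤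
      ∑ j ∈ Finset.range n, w j :=
    Finset.sum_le_sum fun j _ => mul_le_of_le_one_right (hw j) (projIcc _ _ _ _).2.2
  have hsum_nonneg : 0 ≤ ∑ j ∈ Finset.range n, w j * projIcc (0 : ℝ) 1 zero_le_one (n * 0 - j) :=
    Finset.sum_nonneg fun j _ => mul_nonneg (hw j) (projIcc _ _ _ _).2.1
  unfold weightedTime
  linarith

theorem exists_orderIso_of_weights (hw : ∀ j, 0 ≤ w j)
    (hsum : ∑ j ∈ Finset.range n, w j ≤ 1 / 2) :
    ∃ ψ : I ≃o I, ∀ t₁ t₂ : I, t₁ ≤ t₂ →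
      ((t₂ : ℝ) - t₁) / 2 ≤ (ψ t₂ : ℝ) - ψ t₁ ∧
      ∀ j < n, (n : ℝ) * t₁ ≤ j → (j : ℝ) + 1 ≤ n * t₂ → w j ≤ (ψ t₂ : ℝ) - ψ t₁ := by
  have htotal : weightedTime n w (1 : I) - weightedTime n w (0 : I) ≤ 1 :=
    (weightedTime_one_sub_zero_le hw).trans (by linarith)
  obtain ⟨ψ, hψ⟩ := exists_orderIso_sub_le
    ((continuous_weightedTime n w).comp continuous_subtype_val)
    ((strictMono_weightedTime hw).comp fun _ _ h => h) htotal
  exact ⟨ψ, fun t₁ t₂ ht => ⟨(half_sub_le_weightedTime_sub hw ht).trans (hψ t₁ t₂ ht),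
    fun j hj h₁ h₂ => (le_weightedTime_sub hw ht hj h₁ h₂).trans (hψ t₁ t₂ ht)⟩⟩

end WeightedTime

/-! ### Polygonal paths -/

section Polygon

variable {E : Type*} [NormedAddCommGroup E] [NormedSpace ℝ E]

/-- `f` runs linearly, in time `1 / n` for each step, through `v 0, …, v n`: the condition on the
parametrization in the definition of `IsPolygonal`. -/
def RunsThrough (f : I → E) (n : ℕ) (v : ℕ → E) : Prop :=
  ∀ i < n, ∀ t : I, ∀ θ ∈ Icc (0 : ℝ) 1, (n : ℝ) * t = i + θ →
    f t = AffineMap.lineMap (v i) (v (i + 1)) θ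

/-- The time at which a path with `n` steps visits its vertex `i ≤ n`. -/
noncomputable def vertexTime (n i : ℕ) : I :=
  projIcc 0 1 zero_le_one ((i : ℝ) / n)

theorem monotone_vertexTime (n : ℕ) : Monotone (vertexTime n) := fun i j h =>
  monotone_projIcc _ (by gcongr)

theorem mul_vertexTime {n i : ℕ} (hn : 1 ≤ n) (hi : i ≤ n) : (n : ℝ) * vertexTime n i = i := by
  have h : (i : ℝ) / n ∈ Icc (0 : ℝ) 1 :=
    ⟨by positivity, div_le_one_of_le₀ (by exact_mod_cast hi) (by positivity)⟩
  rw [vertexTime, projIcc_of_mem _ h, mul_div_cancel₀ _ (by positivity)]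

theorem exists_mul_mem_Icc {n : ℕ} (hn : 1 ≤ n) (t : I) :
    ∃ i < n, (n : ℝ) * t ∈ Icc (i : ℝ) (i + 1) := by
  have h0 : 0 ≤ (n : ℝ) * t := mul_nonneg n.cast_nonneg t.2.1
  rcases (mul_le_of_le_one_right n.cast_nonneg t.2.2 : (n : ℝ) * t ≤ n).lt_or_eq with h | h
  · exact ⟨_, (Nat.floor_lt h0).2 h, Nat.floor_le h0, (Nat.lt_floor_add_one _).le⟩
  · refine ⟨n - 1, by omega, ?_⟩
    rw [h, Nat.cast_sub hn, Nat.cast_one, sub_add_cancel]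
    exact ⟨sub_le_self _ zero_le_one, le_rfl⟩

namespace RunsThrough

variable {f : I → E} {n : ℕ} {v : ℕ → E} {δ : ℝ} {i : ℕ} {t : I}

theorem apply_eq_lineMap (hf : RunsThrough f n v) (hi : i < n)
    (ht : (n : ℝ) * t ∈ Icc (i : ℝ) (i + 1)) :
    f t = AffineMap.lineMap (v i) (v (i + 1)) ((n : ℝ) * t - i) :=
  hf i hi t _ ⟨sub_nonneg.2 ht.1, sub_le_iff_le_add'.2 ht.2⟩ (add_sub_cancel _ _).symm

theorem apply_vertexTime (hf : RunsThrough f n v) (hn : 1 ≤ n) (hi : i ≤ n) :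
    f (vertexTime n i) = v i := by
  have ht := mul_vertexTime hn hi
  rcases hi.lt_or_eq with h | rfl
  · rw [hf.apply_eq_lineMap h (by rw [ht]; exact ⟨le_rfl, by simp⟩), ht, sub_self,
      AffineMap.lineMap_apply_zero]
  · have hi' : i - 1 + 1 = i := Nat.sub_add_cancel hn
    have hcast : ((i - 1 : ℕ) : ℝ) + 1 = i := by exact_mod_cast hi'
    rw [hf.apply_eq_lineMap (i := i - 1) (by omega) (by rw [ht, ← hcast]; simp), ht, ← hcast,
      add_sub_cancel_left, AffineMap.lineMap_apply_one, hi']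

theorem dist_vertex_left_le (hf : RunsThrough f n v)
    (hv : ∀ i < n, dist (v i) (v (i + 1)) ≤ δ) (hi : i < n)
    (ht : (n : ℝ) * t ∈ Icc (i : ℝ) (i + 1)) : dist (v i) (f t) ≤ (n * t - i) * δ := by
  rw [hf.apply_eq_lineMap hi ht, dist_left_lineMap, Real.norm_of_nonneg (sub_nonneg.2 ht.1)]
  exact mul_le_mul_of_nonneg_left (hv i hi) (sub_nonneg.2 ht.1)

theorem dist_vertex_right_le (hf : RunsThrough f n v)
    (hv : ∀ i < n, dist (v i) (v (i + 1)) ≤ δ) (hi : i < n)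
    (ht : (n : ℝ) * t ∈ Icc (i : ℝ) (i + 1)) : dist (f t) (v (i + 1)) ≤ (i + 1 - n * t) * δ := by
  have h : 0 ≤ (i : ℝ) + 1 - n * t := sub_nonneg.2 ht.2
  have e : 1 - ((n : ℝ) * t - i) = i + 1 - n * t := by ring
  rw [hf.apply_eq_lineMap hi ht, dist_lineMap_right, e, Real.norm_of_nonneg h]
  exact mul_le_mul_of_nonneg_left (hv i hi) h

theorem dist_le (hf : RunsThrough f n v) (hn : 1 ≤ n)
    (hv : ∀ i < n, dist (v i) (v (i + 1)) ≤ δ) {t₁ t₂ : I} (ht : t₁ ≤ t₂) :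
    dist (f t₁) (f t₂) ≤ n * δ * ((t₂ : ℝ) - t₁) := by
  obtain ⟨i₁, hi₁, ht₁⟩ := exists_mul_mem_Icc hn t₁
  obtain ⟨i₂, hi₂, ht₂⟩ := exists_mul_mem_Icc hn t₂
  have hle : (n : ℝ) * t₁ ≤ n * t₂ := by gcongr
  rw [show n * δ * ((t₂ : ℝ) - t₁) = (n * t₂ - n * t₁) * δ by ring]
  rcases lt_trichotomy i₁ i₂ with h | rfl | h
  · have hmid : dist (v (i₁ + 1)) (v i₂) ≤ (i₂ - (i₁ + 1)) * δ := by
      refine (dist_le_Ico_sum_of_dist_le (d := fun _ => δ) (Nat.succ_le_of_lt h)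
        fun {k} _ hk => hv k (hk.trans hi₂)).trans_eq ?_
      rw [Finset.sum_const, Nat.card_Ico, nsmul_eq_mul, Nat.cast_sub (Nat.succ_le_of_lt h),
        Nat.cast_succ]
    calc dist (f t₁) (f t₂)
        ≤ dist (f t₁) (v (i₁ + 1)) + dist (v (i₁ + 1)) (v i₂) + dist (v i₂) (f t₂) :=
          dist_triangle4 _ _ _ _
      _ ≤ (i₁ + 1 - n * t₁) * δ + (i₂ - (i₁ + 1)) * δ + (n * t₂ - i₂) * δ :=
          add_le_add_three (hf.dist_vertex_right_le hv hi₁ ht₁) hmid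
            (hf.dist_vertex_left_le hv hi₂ ht₂)
      _ = (n * t₂ - n * t₁) * δ := by ring
  · rw [hf.apply_eq_lineMap hi₁ ht₁, hf.apply_eq_lineMap hi₁ ht₂, dist_lineMap_lineMap, dist_comm,
      Real.dist_eq, sub_sub_sub_cancel_right, abs_of_nonneg (sub_nonneg.2 hle)]
    exact mul_le_mul_of_nonneg_left (hv i₁ hi₁) (sub_nonneg.2 hle)
  · have h' : (i₂ : ℝ) + 1 ≤ i₁ := by exact_mod_cast h
    have heq : t₁ = t₂ := Subtype.ext <|
      mul_left_cancel₀ (by positivity : (n : ℝ) ≠ 0) (by linarith [ht₁.1, ht₂.2])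
    simp only [heq, dist_self, sub_self, zero_mul, le_refl]

theorem exists_mem_cuts (hf : RunsThrough f n v) (hn : 1 ≤ n)
    (hv : ∀ i < n, dist (v i) (v (i + 1)) ≤ δ) {r : ℝ} (hr : 0 ≤ r) {t₁ t₂ : I} (ht : t₁ ≤ t₂)
    (hd : 2 * r + 2 * δ < dist (f t₁) (f t₂)) :
    ∃ j ∈ cuts v r n, (n : ℝ) * t₁ ≤ j ∧ (j : ℝ) + 1 ≤ n * t₂ := by
  obtain ⟨i₁, hi₁, ht₁⟩ := exists_mul_mem_Icc hn t₁
  obtain ⟨i₂, hi₂, ht₂⟩ := exists_mul_mem_Icc hn t₂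
  have hδ : 0 ≤ δ := dist_nonneg.trans (hv i₁ hi₁)
  have hlt : i₁ < i₂ := by
    by_contra! h
    have h' : (i₂ : ℝ) ≤ i₁ := by exact_mod_cast h
    have hone : (n : ℝ) * t₂ - n * t₁ ≤ 1 := by linarith [ht₁.1, ht₂.2]
    have := mul_le_mul_of_nonneg_right hone hδ
    linarith [hf.dist_le hn hv ht]
  have hfar : 2 * r < dist (v (i₁ + 1)) (v i₂) := by
    have h₁ : ((i₁ : ℝ) + 1 - n * t₁) * δ ≤ 1 * δ := by gcongr; linarith [ht₁.1]
    have h₂ : ((n : ℝ) * t₂ - i₂) * δ ≤ 1 * δ := by gcongr; linarith [ht₂.2]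
    linarith [hf.dist_vertex_right_le hv hi₁ ht₁, hf.dist_vertex_left_le hv hi₂ ht₂,
      dist_triangle4 (f t₁) (v (i₁ + 1)) (v i₂) (f t₂)]
  obtain ⟨j, hj, h₁, h₂⟩ := RandomCurves.exists_mem_cuts v hr (Nat.succ_le_of_lt hlt) hi₂.le hfar
  have h₁' : (i₁ : ℝ) + 1 ≤ j := by exact_mod_cast h₁
  have h₂' : (j : ℝ) + 1 ≤ i₂ := by exact_mod_cast h₂
  exact ⟨j, hj, ht₁.2.trans h₁', h₂'.trans ht₂.1⟩

theorem exists_orderIso_of_weights (hf : RunsThrough f n v) (hn : 1 ≤ n)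
    (hv : ∀ i < n, dist (v i) (v (i + 1)) ≤ δ) (J : Finset ℝ) (hJ : ∀ r ∈ J, 0 ≤ r) {p : ℝ → ℝ}
    (hp : ∀ r ∈ J, 0 ≤ p r) (hsum : ∑ r ∈ J, (cuts v r n).card * p r ≤ 1 / 2) :
    ∃ ψ : I ≃o I, ∀ t₁ t₂ : I, t₁ ≤ t₂ →
      ((t₂ : ℝ) - t₁) / 2 ≤ (ψ t₂ : ℝ) - ψ t₁ ∧
      ∀ r ∈ J, 2 * r + 2 * δ < dist (f t₁) (f t₂) → p r ≤ (ψ t₂ : ℝ) - ψ t₁ := by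
  let w : ℕ → ℝ := fun j => ∑ r ∈ J, if j ∈ cuts v r n then p r else 0
  have hterm (j : ℕ) : ∀ r ∈ J, 0 ≤ if j ∈ cuts v r n then p r else 0 := fun r hr => by
    split_ifs
    exacts [hp r hr, le_rfl]
  have hw : ∑ j ∈ Finset.range n, w j = ∑ r ∈ J, (cuts v r n).card * p r := by
    rw [Finset.sum_comm]
    refine Finset.sum_congr rfl fun r _ => ?_
    rw [Finset.sum_ite_mem, Finset.sum_const, nsmul_eq_mul,
      Finset.inter_eq_right.2 fun j hj => Finset.mem_range.2 (mem_cuts.1 hj).1]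
  obtain ⟨ψ, hψ⟩ := RandomCurves.exists_orderIso_of_weights
    (fun j => Finset.sum_nonneg (hterm j)) (hw.trans_le hsum)
  refine ⟨ψ, fun t₁ t₂ ht => ⟨(hψ t₁ t₂ ht).1, fun r hr hd => ?_⟩⟩
  obtain ⟨j, hj, hj₁, hj₂⟩ := hf.exists_mem_cuts hn hv (hJ r hr) ht hd
  calc p r = if j ∈ cuts v r n then p r else 0 := (if_pos hj).symm
    _ ≤ w j := Finset.single_le_sum (hterm j) hr
    _ ≤ (ψ t₂ : ℝ) - ψ t₁ := (hψ t₁ t₂ ht).2 j (mem_cuts.1 hj).1 hj₁ hj₂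

variable {s a A r₀ c : ℝ}

theorem rpow_dist_le_of_dist_le (hf : RunsThrough f n v) (hn : 1 ≤ n)
    (hv : ∀ i < n, dist (v i) (v (i + 1)) ≤ δ) (hδ₀ : 0 < δ) (hδ₁ : δ ≤ 1) (hs : 1 ≤ s)
    (has : a ≤ s) (hnA : n ≤ A * δ ^ (-a)) (hc : 0 < c) {t₁ t₂ : I} (ht : t₁ ≤ t₂)
    (hd : dist (f t₁) (f t₂) ≤ c * δ) :
    dist (f t₁) (f t₂) ^ s ≤ c ^ (s - 1) * A * ((t₂ : ℝ) - t₁) := by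
  have hΔ : 0 ≤ (t₂ : ℝ) - t₁ := sub_nonneg.2 ht
  have hA : 0 ≤ A := nonneg_of_mul_nonneg_left (n.cast_nonneg.trans hnA) (by positivity)
  have hpow : δ ^ (s - 1) * (δ ^ (-a) * δ) = δ ^ (s - a) := by
    rw [← Real.rpow_add_one hδ₀.ne', ← Real.rpow_add hδ₀]
    ring_nf
  calc dist (f t₁) (f t₂) ^ s
      = dist (f t₁) (f t₂) ^ (s - 1) * dist (f t₁) (f t₂) := by
        rw [← Real.rpow_add_one' dist_nonneg (by linarith), sub_add_cancel]
    _ ≤ (c * δ) ^ (s - 1) * (A * δ ^ (-a) * δ * ((t₂ : ℝ) - t₁)) := by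
        gcongr
        exact (hf.dist_le hn hv ht).trans (by gcongr)
    _ = c ^ (s - 1) * A * (δ ^ (s - 1) * (δ ^ (-a) * δ)) * ((t₂ : ℝ) - t₁) := by
        rw [Real.mul_rpow hc.le hδ₀.le]
        ring
    _ ≤ c ^ (s - 1) * A * 1 * ((t₂ : ℝ) - t₁) := by
        gcongr
        exact hpow.trans_le (Real.rpow_le_one hδ₀.le hδ₁ (sub_nonneg.2 has))
    _ = c ^ (s - 1) * A * ((t₂ : ℝ) - t₁) := by rw [mul_one]

/-- The time is distributed over the cuts of all scales, a cut of scale `r` receiving an amount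
proportional to `r ^ s`. -/
theorem exists_orderIso_rpow_le (hf : RunsThrough f n v) (hn : 1 ≤ n)
    (hv : ∀ i < n, dist (v i) (v (i + 1)) ≤ δ) (hδ : 0 < δ) (has : a < s) (hA : 0 < A)
    (hr₀ : 0 < r₀) (hcuts : ∀ r ∈ dyadicScales δ r₀, (cuts v r n).card ≤ A * r ^ (-a)) :
    ∃ ψ : I ≃o I, ∀ t₁ t₂ : I, t₁ ≤ t₂ →
      ((t₂ : ℝ) - t₁) / 2 ≤ (ψ t₂ : ℝ) - ψ t₁ ∧
      ∀ r ∈ dyadicScales δ r₀, 4 * r < dist (f t₁) (f t₂) →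
        r ^ s ≤ 2 * (r₀ ^ (s - a) / (1 - 2 ^ (-(s - a)))) * A * ((ψ t₂ : ℝ) - ψ t₁) := by
  set S := r₀ ^ (s - a) / (1 - 2 ^ (-(s - a)))
  have hS : 0 < S := div_pos (by positivity) (one_sub_two_rpow_neg_pos (sub_pos.2 has))
  have hpos : ∀ r ∈ dyadicScales δ r₀, 0 < r := fun r hr => pos_of_mem_dyadicScales hδ hr
  have hweights : ∑ r ∈ dyadicScales δ r₀, (cuts v r n).card * (r ^ s / (2 * S * A)) ≤ 1 / 2 :=
    calc ∑ r ∈ dyadicScales δ r₀, (cuts v r n).card * (r ^ s / (2 * S * A))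
        ≤ ∑ r ∈ dyadicScales δ r₀, r ^ (s - a) / (2 * S) := by
          refine Finset.sum_le_sum fun r hr => ?_
          have hr_pos := hpos r hr
          calc (cuts v r n).card * (r ^ s / (2 * S * A))
              ≤ A * r ^ (-a) * (r ^ s / (2 * S * A)) := by gcongr; exact hcuts r hr
            _ = r ^ (-a) * r ^ s / (2 * S) := by field_simp
            _ = r ^ (s - a) / (2 * S) := by rw [← Real.rpow_add hr_pos, neg_add_eq_sub]
      _ = (∑ r ∈ dyadicScales δ r₀, r ^ (s - a)) / (2 * S) := by rw [Finset.sum_div]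
      _ ≤ S / (2 * S) := by
          gcongr
          exact sum_dyadicScales_rpow_le hδ hr₀.le (sub_pos.2 has)
      _ = 1 / 2 := by field_simp
  obtain ⟨ψ, hψ⟩ := hf.exists_orderIso_of_weights hn hv (dyadicScales δ r₀)
    (fun r hr => (hpos r hr).le) (fun r hr => by have := hpos r hr; positivity) hweights
  refine ⟨ψ, fun t₁ t₂ ht => ⟨(hψ t₁ t₂ ht).1, fun r hr hd => ?_⟩⟩
  rw [← div_le_iff₀' (by positivity)]
  exact (hψ t₁ t₂ ht).2 r hr (by linarith [cutoff_le_of_mem_dyadicScales hδ hr])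

theorem exists_orderIso_rpow_dist_le (hf : RunsThrough f n v) (hn : 1 ≤ n)
    (hv : ∀ i < n, dist (v i) (v (i + 1)) ≤ δ) (hδ₀ : 0 < δ) (hδ₁ : δ ≤ 1) (hs : 1 ≤ s)
    (has : a < s) (hr₀ : 0 < r₀) (hnA : n ≤ A * δ ^ (-a))
    (hcuts : ∀ r ∈ dyadicScales δ r₀, (cuts v r n).card ≤ A * r ^ (-a)) (hc : 5 ≤ c)
    (hdist : ∀ t₁ t₂, dist (f t₁) (f t₂) ≤ c * r₀) :
    ∃ ψ : I ≃o I, ∀ t₁ t₂ : I, t₁ ≤ t₂ →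
      dist (f t₁) (f t₂) ^ s ≤
        (2 * c) ^ s * (1 + 2 * (r₀ ^ (s - a) / (1 - 2 ^ (-(s - a))))) * A *
          ((ψ t₂ : ℝ) - ψ t₁) := by
  have hA : 0 < A := pos_of_mul_pos_left
    ((by exact_mod_cast hn : (0 : ℝ) < n).trans_le hnA) (by positivity)
  obtain ⟨ψ, hψ⟩ := hf.exists_orderIso_rpow_le hn hv hδ₀ has hA hr₀ hcuts
  set S := r₀ ^ (s - a) / (1 - 2 ^ (-(s - a)))
  have hS : 0 < S := div_pos (by positivity) (one_sub_two_rpow_neg_pos (sub_pos.2 has))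
  refine ⟨ψ, fun t₁ t₂ ht => ?_⟩
  obtain ⟨hψ_half, hψ_scale⟩ := hψ t₁ t₂ ht
  have hΔ : 0 ≤ (ψ t₂ : ℝ) - ψ t₁ := by
    have : (t₁ : ℝ) ≤ t₂ := ht
    linarith
  rcases le_or_gt (dist (f t₁) (f t₂)) (2 * c * δ) with hd | hd
  · calc dist (f t₁) (f t₂) ^ s
        ≤ (2 * c) ^ (s - 1) * A * ((t₂ : ℝ) - t₁) :=
          hf.rpow_dist_le_of_dist_le hn hv hδ₀ hδ₁ hs has.le hnA (by linarith) ht hd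
      _ ≤ (2 * c) ^ (s - 1) * A * (2 * c * ((ψ t₂ : ℝ) - ψ t₁)) := by
          gcongr
          nlinarith
      _ = (2 * c) ^ s * 1 * A * ((ψ t₂ : ℝ) - ψ t₁) := by
          rw [Real.rpow_sub_one (by linarith)]
          field_simp
      _ ≤ (2 * c) ^ s * (1 + 2 * S) * A * ((ψ t₂ : ℝ) - ψ t₁) := by
          gcongr
          linarith
  · obtain ⟨r, hr, hd_gt, hd_le⟩ := exists_mem_dyadicScales_lt_le hδ₀ hc hd (hdist t₁ t₂)
    have hr_pos := pos_of_mem_dyadicScales hδ₀ hr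
    calc dist (f t₁) (f t₂) ^ s
        ≤ (2 * c * r) ^ s := by gcongr
      _ = (2 * c) ^ s * r ^ s := Real.mul_rpow (by positivity) hr_pos.le
      _ ≤ (2 * c) ^ s * (2 * S * A * ((ψ t₂ : ℝ) - ψ t₁)) := by
          gcongr
          exact hψ_scale r hr hd_gt
      _ = (2 * c) ^ s * (2 * S) * A * ((ψ t₂ : ℝ) - ψ t₁) := by ring
      _ ≤ (2 * c) ^ s * (1 + 2 * S) * A * ((ψ t₂ : ℝ) - ψ t₁) := by
          gcongr
          linarith

end RunsThrough

end Polygon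

/-! ### Nets in bounded sets -/

section Nets

open Metric Module

theorem card_mul_pow_le_of_isSeparated {E : Type*} [NormedAddCommGroup E] [NormedSpace ℝ E]
    [FiniteDimensional ℝ E] {s : Finset E} {ε : NNReal} {b : ℝ} (hε : 0 < ε)
    (hs : IsSeparated ε (s : Set E)) (hb : ∀ x ∈ s, ‖x‖ ≤ b) (hb₀ : 0 ≤ b) :
    s.card * ((ε : ℝ) / 2) ^ finrank ℝ E ≤ (b + ε / 2) ^ finrank ℝ E := by
  borelize E
  let ν : Measure E := Measure.addHaar
  have hε₂ : 0 < (ε : ℝ) / 2 := by positivity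
  have hdisj : (s : Set E).Pairwise (Function.onFun Disjoint fun x => ball x ((ε : ℝ) / 2)) :=
    fun x hx y hy hxy => ball_disjoint_ball <| by
      have h : (ε : ENNReal) < edist x y := hs hx hy hxy
      rw [edist_nndist, ENNReal.coe_lt_coe] at h
      rw [add_halves, ← coe_nndist]
      exact_mod_cast h.le
  have hsub : ⋃ x ∈ s, ball x ((ε : ℝ) / 2) ⊆ ball 0 (b + ε / 2) :=
    iUnion₂_subset fun x hx => ball_subset_ball' <| by
      rw [dist_zero_right, add_comm]
      exact add_le_add_left (hb x hx) _
  have hvol : s.card * ENNReal.ofReal (((ε : ℝ) / 2) ^ finrank ℝ E) * ν (ball 0 1) ≤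
      ENNReal.ofReal ((b + ε / 2) ^ finrank ℝ E) * ν (ball 0 1) :=
    calc s.card * ENNReal.ofReal (((ε : ℝ) / 2) ^ finrank ℝ E) * ν (ball 0 1)
        = ν (⋃ x ∈ s, ball x ((ε : ℝ) / 2)) := by
          rw [measure_biUnion_finset hdisj fun x _ => measurableSet_ball]
          simp only [ν.addHaar_ball_of_pos _ hε₂, Finset.sum_const, nsmul_eq_mul, mul_assoc]
      _ ≤ ν (ball 0 (b + ε / 2)) := measure_mono hsub
      _ = ENNReal.ofReal ((b + ε / 2) ^ finrank ℝ E) * ν (ball 0 1) :=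
          ν.addHaar_ball_of_pos _ (by positivity)
  rwa [ENNReal.mul_le_mul_iff_left (measure_ball_pos _ _ zero_lt_one).ne' measure_ball_lt_top.ne,
    ← ENNReal.ofReal_natCast, ← ENNReal.ofReal_mul (by positivity),
    ENNReal.ofReal_le_ofReal_iff (by positivity)] at hvol

theorem packingNumber_ne_top_of_totallyBounded {X : Type*} [PseudoEMetricSpace X] {A : Set X}
    (hA : TotallyBounded A) {ε : NNReal} (hε : 0 < ε) : packingNumber ε A ≠ ⊤ := by
  obtain ⟨N, -, hN, hcover⟩ := exists_finite_isCover_of_totallyBounded (half_pos hε).ne' hA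
  rw [← mul_div_cancel₀ ε two_ne_zero]
  exact ((packingNumber_two_mul_le_externalCoveringNumber _ A).trans
    hcover.externalCoveringNumber_le_encard).trans_lt hN.encard_lt_top |>.ne

variable {d : ℕ}

/-- `T ℓ` is an `ℓ`-net of `Λ` with at most `B ℓ⁻ᵈ` points, for every scale `ℓ ∈ (0, 1]`. The points
of these nets are the centers of the shells whose crossings are counted. -/
def IsNetFamily (Λ : Set (EuclideanSpace ℝ (Fin d))) (B : ℝ)
    (T : ℝ → Finset (EuclideanSpace ℝ (Fin d))) : Prop :=
  ∀ ℓ ∈ Ioc (0 : ℝ) 1, (T ℓ).card ≤ B * ℓ ^ (-(d : ℝ)) ∧ ∀ y ∈ Λ, ∃ x ∈ T ℓ, dist y x ≤ ℓ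

theorem exists_isNetFamily {Λ : Set (EuclideanSpace ℝ (Fin d))} (hΛ : Bornology.IsBounded Λ) :
    ∃ B T, 0 < B ∧ IsNetFamily Λ B T := by
  obtain ⟨b, hb₀, hb⟩ := hΛ.subset_closedBall_lt 0 0
  suffices ∀ ℓ ∈ Ioc (0 : ℝ) 1, ∃ T : Finset (EuclideanSpace ℝ (Fin d)),
      T.card ≤ (2 * b + 1) ^ d * ℓ ^ (-(d : ℝ)) ∧ ∀ y ∈ Λ, ∃ x ∈ T, dist y x ≤ ℓ by
    choose! T hT using this
    exact ⟨_, T, by positivity, hT⟩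
  rintro ℓ ⟨hℓ₀, hℓ₁⟩
  lift ℓ to NNReal using hℓ₀.le
  have hpack := packingNumber_ne_top_of_totallyBounded
    ((isCompact_closedBall _ _).totallyBounded.subset hb) (ε := ℓ) (by exact_mod_cast hℓ₀)
  have hfin : (maximalSeparatedSet ℓ Λ).Finite := by
    rwa [← encard_ne_top_iff, encard_maximalSeparatedSet hpack]
  refine ⟨hfin.toFinset, ?_, fun y hy => ?_⟩
  · have hcard := card_mul_pow_le_of_isSeparated (s := hfin.toFinset) (ε := ℓ) (b := b)
      (by exact_mod_cast hℓ₀) (by rw [hfin.coe_toFinset]; exact isSeparated_maximalSeparatedSet)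
      (fun x hx => by simpa using hb (maximalSeparatedSet_subset (hfin.mem_toFinset.1 hx))) hb₀.le
    rw [finrank_euclideanSpace_fin, ← le_div_iff₀ (by positivity), ← div_pow] at hcard
    rw [Real.rpow_neg hℓ₀.le, Real.rpow_natCast, ← div_eq_mul_inv, ← div_pow]
    refine hcard.trans (pow_le_pow_left₀ (by positivity) ?_ d)
    rw [div_le_div_iff₀ (by positivity) hℓ₀]
    nlinarith
  · obtain ⟨x, hx, hyx⟩ := isCover_maximalSeparatedSet hpack hy
    refine ⟨x, hfin.mem_toFinset.2 hx, ?_⟩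
    rw [dist_edist]
    exact ENNReal.toReal_le_coe_of_le_coe hyx

end Nets

/-! ### Crossings of shells by polygonal paths -/

section Crossings

variable {d : ℕ} {Λ : Set (EuclideanSpace ℝ (Fin d))} {C : Curve Λ} {γ : ParamCurve Λ} {n k : ℕ}
  {v : ℕ → EuclideanSpace ℝ (Fin d)} {x : EuclideanSpace ℝ (Fin d)} {r ℓ R : ℝ}

theorem traversed_of_subset_cuts (hC : Parametrizes γ C)
    (hf : RunsThrough (fun t => (γ.toMap t : EuclideanSpace ℝ (Fin d))) n v) (hn : 1 ≤ n)
    {P : Finset ℕ} (hP : P ⊆ cuts v r n) (hk : k ≤ P.card)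
    (hx : ∀ j ∈ P, dist (v (lastCut v r j)) x ≤ ℓ) (hR : R + ℓ ≤ r) : Traversed C k x ℓ R := by
  set e := P.orderEmbOfCardLe hk
  have he (i : Fin k) : e i ∈ P := P.orderEmbOfCardLe_mem hk i
  have hcut (i : Fin k) := mem_cuts.1 (hP (he i))
  refine ⟨γ, hC, fun i => vertexTime n (lastCut v r (e i)), fun i => vertexTime n (e i + 1),
    fun i => monotone_vertexTime n ((lastCut_le v r _).trans (Nat.le_succ _)),
    fun i j hij => monotone_vertexTime n
      (lt_lastCut_of_mem_cuts (hP (he i)) (e.strictMono hij)),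
    fun i => Or.inl ?_⟩
  rw [hf.apply_vertexTime hn ((lastCut_le v r (e i)).trans (hcut i).1.le),
    hf.apply_vertexTime hn (Nat.succ_le_of_lt (hcut i).1)]
  refine ⟨hx _ (he i), ?_⟩
  linarith [(hcut i).2, hx _ (he i), dist_triangle_right (v (e i + 1)) (v (lastCut v r (e i))) x]

theorem exists_le_dist_of_four_mul_le_diam (hR₀ : 0 < R)
    (hR : 4 * R ≤ Metric.diam (range γ.toMap)) (x : EuclideanSpace ℝ (Fin d)) :
    ∃ t : I, R ≤ dist (γ.toMap t : EuclideanSpace ℝ (Fin d)) x := by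
  by_contra! h
  have hdiam : Metric.diam (range γ.toMap) ≤ 2 * R := by
    refine Metric.diam_le_of_forall_dist_le (by linarith) ?_
    rintro _ ⟨p, rfl⟩ _ ⟨q, rfl⟩
    rw [Subtype.dist_eq]
    linarith [h p, h q,
      dist_triangle_right (γ.toMap p : EuclideanSpace ℝ (Fin d)) (γ.toMap q) x]
  linarith

theorem traversed_one_of_dist_le (hC : Parametrizes γ C) (hR₀ : 0 < R)
    (hR : 4 * R ≤ Metric.diam (range γ.toMap)) {t : I}
    (ht : dist (γ.toMap t : EuclideanSpace ℝ (Fin d)) x ≤ ℓ) : Traversed C 1 x ℓ R := by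
  obtain ⟨t', ht'⟩ := exists_le_dist_of_four_mul_le_diam hR₀ hR x
  have hlt (i j : Fin 1) : ¬ i < j := by simp [Subsingleton.elim i j]
  rcases le_total t t' with h | h
  · exact ⟨γ, hC, fun _ => t, fun _ => t', fun _ => h, fun i j hij => absurd hij (hlt i j),
      fun _ => Or.inl ⟨ht, ht'⟩⟩
  · exact ⟨γ, hC, fun _ => t', fun _ => t, fun _ => h, fun i j hij => absurd hij (hlt i j),
      fun _ => Or.inr ⟨ht', ht⟩⟩

theorem Traversed.anti_outer {R' : ℝ} (h : Traversed C k x ℓ R) (hR : R' ≤ R) :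
    Traversed C k x ℓ R' := by
  obtain ⟨γ, hC, s, t, hst, hts, hcross⟩ := h
  exact ⟨γ, hC, s, t, hst, hts, fun i => (hcross i).imp (And.imp_right hR.trans)
    (And.imp_left hR.trans)⟩

open Classical in
/-- The points `x` of `T` such that some curve of `F` traverses the shell `D(x; ℓ, R)`. -/
noncomputable def crossedPoints (T : Finset (EuclideanSpace ℝ (Fin d))) (F : Config Λ)
    (ℓ R : ℝ) : Finset (EuclideanSpace ℝ (Fin d)) :=
  T.filter fun x => ∃ C ∈ F, Traversed C 1 x ℓ R

theorem mem_crossedPoints {T : Finset (EuclideanSpace ℝ (Fin d))} {F : Config Λ} :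
    x ∈ crossedPoints T F ℓ R ↔ x ∈ T ∧ ∃ C ∈ F, Traversed C 1 x ℓ R := by
  simp only [crossedPoints, Finset.mem_filter]

theorem crossedPoints_anti_outer (T : Finset (EuclideanSpace ℝ (Fin d))) (F : Config Λ) (ℓ : ℝ)
    {R' : ℝ} (hR : R' ≤ R) : crossedPoints T F ℓ R ⊆ crossedPoints T F ℓ R' := fun x hx => by
  obtain ⟨hxT, C, hCF, hC⟩ := mem_crossedPoints.1 hx
  exact mem_crossedPoints.2 ⟨hxT, C, hCF, hC.anti_outer hR⟩

end Crossings

/-! ### Probability estimates -/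

section Probability

theorem exists_measurable_nat_ae_notMem {Ω : Type*} [MeasurableSpace Ω] (ν : Measure Ω)
    (A : ℕ → Set Ω) (hA : ⨅ u, ν (A u) = 0) :
    ∃ X : Ω → ℕ, Measurable X ∧ (∀ u, ν {ω | u < X ω} ≤ ν (A u)) ∧ ∀ᵐ ω ∂ν, ω ∉ A (X ω) := by
  classical
  let H : ℕ → Set Ω := fun u => toMeasurable ν (A u)
  have hH (u : ℕ) : MeasurableSet (H u) := measurableSet_toMeasurable ν (A u)
  have hex (ω : Ω) : ∃ u, ω ∉ H u ∨ ω ∈ ⋂ u, H u := by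
    by_cases hω : ω ∈ ⋂ u, H u
    · exact ⟨0, Or.inr hω⟩
    · obtain ⟨u, hu⟩ := not_forall.1 (mt mem_iInter.2 hω)
      exact ⟨u, Or.inl hu⟩
  have hnull : ν (⋂ u, H u) = 0 := le_antisymm
    (hA ▸ le_iInf fun u => (measure_mono (iInter_subset H u)).trans_eq (measure_toMeasurable _))
    zero_le
  refine ⟨fun ω => Nat.find (hex ω),
    measurable_find hex fun u => (hH u).compl.union (MeasurableSet.iInter hH), fun u => ?_, ?_⟩
  · rw [← measure_toMeasurable (A u)]
    exact measure_mono fun ω hω => by_contra fun h => Nat.find_min (hex ω) hω (Or.inl h)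
  · filter_upwards [measure_eq_zero_iff_ae_notMem.1 hnull] with ω hω
    exact fun h => (Nat.find_spec (hex ω)).resolve_right hω (subset_toMeasurable ν _ h)

theorem exists_stochasticallyBounded {Ω : Type*} [MeasurableSpace Ω] {δmax : ℝ}
    {μ : ℝ → Measure Ω} (A : ℝ → ℕ → Set Ω)
    (hA : ∀ η : ℝ, 0 < η → ∃ u : ℕ, ∀ δ ∈ Ioc 0 δmax, μ δ (A δ u) ≤ ENNReal.ofReal η) :
    ∃ κ : ℝ → Ω → ℝ, (∀ δ ∈ Ioc 0 δmax, Measurable (κ δ)) ∧ StochasticallyBounded δmax μ κ ∧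
      ∀ δ ∈ Ioc 0 δmax, ∀ᵐ ω ∂μ δ, ∃ u : ℕ, κ δ ω = u ∧ ω ∉ A δ u := by
  have hinf : ∀ δ ∈ Ioc 0 δmax, ⨅ u, μ δ (A δ u) = 0 := fun δ hδ => by
    refine le_antisymm (ENNReal.le_of_forall_pos_le_add fun η hη _ => ?_) zero_le
    obtain ⟨u, hu⟩ := hA η hη
    rw [zero_add, ← ENNReal.ofReal_coe_nnreal]
    exact (iInf_le _ u).trans (hu δ hδ)
  choose! X hXm hXle hXae using fun δ hδ => exists_measurable_nat_ae_notMem (μ δ) (A δ) (hinf δ hδ)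
  refine ⟨fun δ ω => X δ ω, fun δ hδ => measurable_from_nat.comp (hXm δ hδ), fun η hη => ?_,
    fun δ hδ => (hXae δ hδ).mono fun ω hω => ⟨_, rfl, hω⟩⟩
  obtain ⟨u, hu⟩ := hA η hη
  refine ⟨u + 1, fun δ hδ => (measure_mono fun ω (hω : (u : ℝ) + 1 ≤ |(X δ ω : ℝ)|) => ?_).trans
    ((hXle δ hδ u).trans (hu δ hδ))⟩
  rw [Nat.abs_cast] at hω
  exact Nat.lt_of_succ_le (by exact_mod_cast hω)

open Classical in
theorem measure_le_card_filter_le {Ω ι : Type*} [MeasurableSpace Ω] (ν : Measure Ω) (T : Finset ι)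
    (A : ι → Set Ω) {p c : ℝ} (hc : 0 < c) (h : ∀ x ∈ T, ν (A x) ≤ ENNReal.ofReal p) :
    ν {ω | c ≤ (T.filter fun x => ω ∈ A x).card} ≤ ENNReal.ofReal (T.card * p / c) := by
  let H : ι → Set Ω := fun x => toMeasurable ν (A x)
  have hind (x : ι) : Measurable ((H x).indicator (1 : Ω → ℝ≥0∞)) :=
    measurable_one.indicator (measurableSet_toMeasurable ν (A x))
  have hcount : {ω | c ≤ (T.filter fun x => ω ∈ A x).card} ⊆
      {ω | ENNReal.ofReal c ≤ ∑ x ∈ T, (H x).indicator 1 ω} := by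
    intro ω hω
    refine (ENNReal.ofReal_le_ofReal hω).trans ?_
    rw [ENNReal.ofReal_natCast, Finset.card_filter, Nat.cast_sum]
    refine Finset.sum_le_sum fun x _ => ?_
    split_ifs with hx
    · rw [indicator_of_mem (subset_toMeasurable ν _ hx), Nat.cast_one, Pi.one_apply]
    · exact Nat.cast_zero.trans_le zero_le
  have hmean : ∫⁻ ω, ∑ x ∈ T, (H x).indicator 1 ω ∂ν ≤ ENNReal.ofReal (T.card * p) :=
    calc ∫⁻ ω, ∑ x ∈ T, (H x).indicator 1 ω ∂ν
        = ∑ x ∈ T, ν (A x) := by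
          rw [lintegral_finsetSum _ fun x _ => hind x]
          refine Finset.sum_congr rfl fun x _ => ?_
          rw [lintegral_indicator_one (measurableSet_toMeasurable ν _), measure_toMeasurable]
      _ ≤ ∑ _x ∈ T, ENNReal.ofReal p := Finset.sum_le_sum h
      _ = ENNReal.ofReal (T.card * p) := by
          rw [Finset.sum_const, nsmul_eq_mul, ENNReal.ofReal_mul (by positivity),
            ENNReal.ofReal_natCast]
  rw [ENNReal.ofReal_div_of_pos hc]
  exact (measure_mono hcount).trans
    ((meas_ge_le_lintegral_div (Finset.measurable_fun_sum T fun x _ => hind x).aemeasurable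
      (by simpa using hc) ENNReal.ofReal_ne_top).trans (ENNReal.div_le_div_right hmean _))

variable {d : ℕ} {Λ : Set (EuclideanSpace ℝ (Fin d))} {ν : Measure (Config Λ)} {δ : ℝ} {k : ℕ}
  {K l : ℝ} {B : ℝ} {T : ℝ → Finset (EuclideanSpace ℝ (Fin d))}

/-- The power bound of hypothesis **H1** for a single measure `ν` and a single number `k` of
crossings, with cutoff `δ`, constant `K` and exponent `l`. -/
def HasCrossingBound (ν : Measure (Config Λ)) (δ : ℝ) (k : ℕ) (K l : ℝ) : Prop :=
  ∀ (x : EuclideanSpace ℝ (Fin d)) (r R : ℝ), δ ≤ r → r < R → R ≤ 1 →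
    ν {F | ∃ C ∈ F, Traversed C k x r R} ≤ ENNReal.ofReal (K * (r / R) ^ l)

theorem HasCrossingBound.abs (h : HasCrossingBound ν δ k K l) (hδ : 0 < δ) :
    HasCrossingBound ν δ k |K| l := fun x r R hr hrR hR =>
  (h x r R hr hrR hR).trans <| ENNReal.ofReal_le_ofReal <| mul_le_mul_of_nonneg_right
    (le_abs_self K) (Real.rpow_nonneg (div_nonneg (hδ.le.trans hr) (by linarith)) l)

theorem measure_le_card_crossedPoints_le (hν : HasCrossingBound ν δ 1 K l)
    (hT : IsNetFamily Λ B T) (hK : 0 ≤ K) {ℓ R c : ℝ} (hδ : 0 < δ) (hδℓ : δ ≤ ℓ) (hℓR : ℓ < R)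
    (hR : R ≤ 1) (hc : 0 < c) :
    ν {F | c ≤ (crossedPoints (T ℓ) F ℓ R).card} ≤
      ENNReal.ofReal (B * K / c * ℓ ^ (l - d) * R ^ (-l)) := by
  have hℓ : 0 < ℓ := hδ.trans_le hδℓ
  have hR₀ : 0 < R := hℓ.trans hℓR
  refine (measure_le_card_filter_le ν (T ℓ) (fun x => {F | ∃ C ∈ F, Traversed C 1 x ℓ R}) hc
    fun x _ => hν x ℓ R hδℓ hℓR hR).trans (ENNReal.ofReal_le_ofReal ?_)
  calc (T ℓ).card * (K * (ℓ / R) ^ l) / c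
      ≤ B * ℓ ^ (-(d : ℝ)) * (K * (ℓ / R) ^ l) / c := by
        gcongr
        exact (hT ℓ ⟨hℓ, hℓR.le.trans hR⟩).1
    _ = B * K / c * (ℓ ^ (-(d : ℝ)) * ℓ ^ l) * R ^ (-l) := by
        rw [Real.div_rpow hℓ.le hR₀.le, Real.rpow_neg hR₀.le]
        ring
    _ = B * K / c * ℓ ^ (l - d) * R ^ (-l) := by rw [← Real.rpow_add hℓ, neg_add_eq_sub]

/-- At every dyadic scale `ℓ ∈ [δ, 1]`, the number of points of the net from which curves of `F`
cross to a distance `R` is, up to the factor `u`, of the order of its mean value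
`ℓ ^ (l - d) R ^ (-l)`; the exponent `a` is to be taken slightly larger than `d - l`. -/
def FewCrossings (T : ℝ → Finset (EuclideanSpace ℝ (Fin d))) (δ a l u : ℝ) (F : Config Λ) : Prop :=
  ∀ ℓ ∈ dyadicScales δ 1, ∀ R ∈ Ioc (0 : ℝ) 1,
    (crossedPoints (T ℓ) F ℓ R).card ≤ u * ℓ ^ (-a) * R ^ (-l)

theorem card_crossedPoints_le_of_dyadicScales (hT : IsNetFamily Λ B T) (hB : 0 ≤ B) (hl : 0 ≤ l)
    {a u ℓ : ℝ} (ha : d - l ≤ a) (hu : B * 2 ^ l ≤ u) (hℓ : ℓ ∈ Ioc (0 : ℝ) 1) {F : Config Λ}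
    (h : ∀ R ∈ dyadicScales ℓ 1, ℓ < R →
      (crossedPoints (T ℓ) F ℓ R).card ≤ u / 2 ^ l * ℓ ^ (-a) * R ^ (-l))
    {R : ℝ} (hR : R ∈ Ioc (0 : ℝ) 1) :
    (crossedPoints (T ℓ) F ℓ R).card ≤ u * ℓ ^ (-a) * R ^ (-l) := by
  have hℓ₀ := hℓ.1
  have hu₀ : 0 ≤ u := hu.trans' (by positivity)
  have hhalf {r : ℝ} (hr : R ≤ 2 * r) : r ^ (-l) ≤ 2 ^ l * R ^ (-l) := by
    have hR₀ := hR.1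
    calc r ^ (-l) ≤ (R / 2) ^ (-l) :=
          Real.rpow_le_rpow_of_nonpos (by positivity) (by linarith) (by linarith)
      _ = 2 ^ l * R ^ (-l) := by
          rw [Real.div_rpow hR₀.le zero_le_two, Real.rpow_neg zero_le_two, div_inv_eq_mul, mul_comm]
  rcases le_or_gt R (2 * ℓ) with hRℓ | hRℓ
  · calc ((crossedPoints (T ℓ) F ℓ R).card : ℝ)
        ≤ (T ℓ).card := by
          exact_mod_cast Finset.card_le_card fun x hx => (mem_crossedPoints.1 hx).1
      _ ≤ B * ℓ ^ (-(d : ℝ)) := (hT ℓ hℓ).1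
      _ ≤ B * ℓ ^ (-a + -l) := by
          gcongr B * ?_
          exact Real.rpow_le_rpow_of_exponent_ge hℓ₀ hℓ.2 (by linarith)
      _ ≤ B * (ℓ ^ (-a) * (2 ^ l * R ^ (-l))) := by
          rw [Real.rpow_add hℓ₀]
          gcongr
          exact hhalf hRℓ
      _ = B * 2 ^ l * ℓ ^ (-a) * R ^ (-l) := by ring
      _ ≤ u * ℓ ^ (-a) * R ^ (-l) := by
          have := hR.1
          gcongr
  · obtain ⟨R', hR', hle, hlt⟩ := exists_mem_dyadicScales (ℓ₀ := 1) hℓ₀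
      (by linarith : ℓ ≤ R) hR.2
    calc ((crossedPoints (T ℓ) F ℓ R).card : ℝ)
        ≤ (crossedPoints (T ℓ) F ℓ R').card := by
          exact_mod_cast Finset.card_le_card (crossedPoints_anti_outer _ _ _ hle)
      _ ≤ u / 2 ^ l * ℓ ^ (-a) * R' ^ (-l) := h R' hR' (by linarith)
      _ ≤ u / 2 ^ l * ℓ ^ (-a) * (2 ^ l * R ^ (-l)) := by
          gcongr
          exact hhalf hlt.le
      _ = u * ℓ ^ (-a) * R ^ (-l) := by field_simp

theorem measure_biUnion_lt_card_crossedPoints_le (hν : HasCrossingBound ν δ 1 K l)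
    (hT : IsNetFamily Λ B T) (hB : 0 ≤ B) (hK : 0 ≤ K) {a e u ℓ : ℝ} (he : 0 < e)
    (ha : d - l + 2 * e = a) (hu : 0 < u) (hδ : 0 < δ) (hδℓ : δ ≤ ℓ) :
    ν (⋃ R ∈ dyadicScales ℓ 1, {F | ℓ < R ∧
      u / 2 ^ l * ℓ ^ (-a) * R ^ (-l) < (crossedPoints (T ℓ) F ℓ R).card}) ≤
    ENNReal.ofReal (B * K * 2 ^ l / u / (1 - 2 ^ (-e)) * ℓ ^ e) := by
  have hℓ : 0 < ℓ := hδ.trans_le hδℓ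
  refine (measure_biUnion_dyadicScales_le hℓ zero_le_one
    (by positivity : 0 ≤ B * K * 2 ^ l / u * ℓ ^ e) he fun R hR => ?_).trans_eq ?_
  · have hR₀ := pos_of_mem_dyadicScales hℓ hR
    rcases (cutoff_le_of_mem_dyadicScales hℓ hR).eq_or_lt with rfl | hℓR
    · simp only [lt_irrefl, false_and, ofPred_false, measure_empty, zero_le]
    refine (measure_mono fun F hF => hF.2.le).trans ((measure_le_card_crossedPoints_le hν hT hK hδ
      hδℓ hℓR (le_of_mem_dyadicScales hR) (by positivity)).trans (ENNReal.ofReal_le_ofReal ?_))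
    calc B * K / (u / 2 ^ l * ℓ ^ (-a) * R ^ (-l)) * ℓ ^ (l - d) * R ^ (-l)
        = B * K * 2 ^ l / u * (ℓ ^ a * ℓ ^ (l - d)) := by
          rw [Real.rpow_neg hℓ.le]
          field_simp
      _ = B * K * 2 ^ l / u * ℓ ^ e * ℓ ^ e := by
          rw [mul_assoc (B * K * 2 ^ l / u), ← Real.rpow_add hℓ, ← Real.rpow_add hℓ, ← ha]
          ring_nf
      _ ≤ B * K * 2 ^ l / u * ℓ ^ e * R ^ e := by gcongr
  · rw [Real.one_rpow]
    ring_nf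

theorem exists_measure_not_fewCrossings_le (hT : IsNetFamily Λ B T) (hB : 0 < B) (hK : 0 ≤ K)
    (hl : 0 ≤ l) {a η : ℝ} (ha : d - l < a) (hη : 0 < η) :
    ∃ u > 0, ∀ δ > 0, ∀ ν : Measure (Config Λ), HasCrossingBound ν δ 1 K l →
      ν {F | ¬ FewCrossings T δ a l u F} ≤ ENNReal.ofReal η := by
  obtain ⟨e, he, ha⟩ : ∃ e > 0, d - l + 2 * e = a := ⟨(a - (d - l)) / 2, by linarith, by ring⟩
  have hq := one_sub_two_rpow_neg_pos he
  set u := max (B * 2 ^ l) (B * K * 2 ^ l / (1 - 2 ^ (-e)) / (1 - 2 ^ (-e)) / η)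
  have hu : 0 < u := lt_max_of_lt_left (by positivity)
  refine ⟨u, hu, fun δ hδ ν hν => ?_⟩
  have hsub : {F : Config Λ | ¬ FewCrossings T δ a l u F} ⊆
      ⋃ ℓ ∈ dyadicScales δ 1, ⋃ R ∈ dyadicScales ℓ 1, {F | ℓ < R ∧
        u / 2 ^ l * ℓ ^ (-a) * R ^ (-l) < (crossedPoints (T ℓ) F ℓ R).card} := by
    intro F hF
    by_contra hgood
    simp only [mem_iUnion, mem_ofPred_eq, not_exists, not_and, not_lt] at hgood
    exact hF fun ℓ hℓ R hR => card_crossedPoints_le_of_dyadicScales hT hB.le hl (by linarith)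
      (le_max_left _ _) ⟨pos_of_mem_dyadicScales hδ hℓ, le_of_mem_dyadicScales hℓ⟩ (hgood ℓ hℓ) hR
  refine (measure_mono hsub).trans ((measure_biUnion_dyadicScales_le hδ zero_le_one (by positivity)
    he fun ℓ hℓ => measure_biUnion_lt_card_crossedPoints_le hν hT hB.le hK he ha hu hδ
      (cutoff_le_of_mem_dyadicScales hδ hℓ)).trans (ENNReal.ofReal_le_ofReal ?_))
  calc B * K * 2 ^ l / u / (1 - 2 ^ (-e)) * (1 ^ e / (1 - 2 ^ (-e)))
      = B * K * 2 ^ l / (1 - 2 ^ (-e)) / (1 - 2 ^ (-e)) / u := by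
        rw [Real.one_rpow]
        ring
    _ ≤ η := by
        rw [div_le_comm₀ hu hη]
        exact le_max_right _ _

/-- At every dyadic scale `ℓ ∈ [δ, ℓ₀]`, no shell with inner radius `ℓ` and outer radius `ℓ ^ α`
about a point of the net is traversed `k` times by a curve of `F`. -/
def NoMultipleCrossing (T : ℝ → Finset (EuclideanSpace ℝ (Fin d))) (δ α : ℝ) (k : ℕ) (ℓ₀ : ℝ)
    (F : Config Λ) : Prop :=
  ∀ ℓ ∈ dyadicScales δ ℓ₀, ∀ x ∈ T ℓ, ¬ ∃ C ∈ F, Traversed C k x ℓ (ℓ ^ α)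

theorem measure_biUnion_traversed_le (hν : HasCrossingBound ν δ k K l) (hT : IsNetFamily Λ B T)
    (hK : 0 ≤ K) {α ℓ : ℝ} (hα₀ : 0 ≤ α) (hα₁ : α < 1) (hδℓ : δ ≤ ℓ) (hℓ₀ : 0 < ℓ) (hℓ₁ : ℓ < 1) :
    ν (⋃ x ∈ T ℓ, {F | ∃ C ∈ F, Traversed C k x ℓ (ℓ ^ α)}) ≤
      ENNReal.ofReal (B * K * ℓ ^ ((1 - α) * l - d)) := by
  have hout : ℓ < ℓ ^ α := Real.self_lt_rpow_of_lt_one hℓ₀ hℓ₁ hα₁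
  calc ν (⋃ x ∈ T ℓ, {F | ∃ C ∈ F, Traversed C k x ℓ (ℓ ^ α)})
      ≤ ∑ x ∈ T ℓ, ν {F | ∃ C ∈ F, Traversed C k x ℓ (ℓ ^ α)} := measure_biUnion_finset_le _ _
    _ ≤ ∑ _x ∈ T ℓ, ENNReal.ofReal (K * (ℓ / ℓ ^ α) ^ l) := Finset.sum_le_sum fun x _ =>
        hν x ℓ _ hδℓ hout (Real.rpow_le_one hℓ₀.le hℓ₁.le hα₀)
    _ = ENNReal.ofReal ((T ℓ).card * (K * ℓ ^ ((1 - α) * l))) := by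
        rw [Finset.sum_const, nsmul_eq_mul, ENNReal.ofReal_mul (Nat.cast_nonneg _),
          ENNReal.ofReal_natCast, Real.rpow_mul hℓ₀.le, Real.rpow_sub hℓ₀, Real.rpow_one]
    _ ≤ ENNReal.ofReal (B * ℓ ^ (-(d : ℝ)) * (K * ℓ ^ ((1 - α) * l))) := by
        gcongr
        exact (hT ℓ ⟨hℓ₀, hℓ₁.le⟩).1
    _ = ENNReal.ofReal (B * K * ℓ ^ ((1 - α) * l - d)) := by
        rw [sub_eq_neg_add _ (d : ℝ), Real.rpow_add hℓ₀]
        ring_nf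

theorem exists_measure_not_noMultipleCrossing_le (hT : IsNetFamily Λ B T) (hB : 0 ≤ B)
    (hK : 0 ≤ K) {α η : ℝ} (hα₀ : 0 ≤ α) (hα₁ : α < 1) (hα : d < (1 - α) * l) (hη : 0 < η) :
    ∃ ℓ₀ ∈ Ioo (0 : ℝ) 1, ∀ δ > 0, ∀ ν : Measure (Config Λ), HasCrossingBound ν δ k K l →
      ν {F | ¬ NoMultipleCrossing T δ α k ℓ₀ F} ≤ ENNReal.ofReal η := by
  set e := (1 - α) * l - d
  have he : 0 < e := sub_pos.2 hα
  have hlim : Tendsto (fun ℓ₀ : ℝ => B * K * (ℓ₀ ^ e / (1 - 2 ^ (-e)))) (𝓝[>] 0) (𝓝 0) := by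
    have hcont : Continuous fun ℓ₀ : ℝ => B * K * (ℓ₀ ^ e / (1 - 2 ^ (-e))) :=
      ((Real.continuous_rpow_const he.le).div_const _).const_mul _
    exact (hcont.tendsto' 0 0 (by rw [Real.zero_rpow he.ne']; simp)).mono_left nhdsWithin_le_nhds
  obtain ⟨ℓ₀, hsmall, hℓ₀⟩ :=
    ((hlim.eventually_le_const hη).and (Ioo_mem_nhdsGT zero_lt_one)).exists
  refine ⟨ℓ₀, hℓ₀, fun δ hδ ν hν => ?_⟩
  have hsub : {F : Config Λ | ¬ NoMultipleCrossing T δ α k ℓ₀ F} ⊆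
      ⋃ ℓ ∈ dyadicScales δ ℓ₀, ⋃ x ∈ T ℓ, {F | ∃ C ∈ F, Traversed C k x ℓ (ℓ ^ α)} := by
    intro F hF
    by_contra hgood
    simp only [mem_iUnion, mem_ofPred_eq, not_exists] at hgood
    exact hF fun ℓ hℓ x hx ⟨C, hC⟩ => hgood ℓ hℓ x hx C hC
  exact (measure_mono hsub).trans ((measure_biUnion_dyadicScales_le hδ hℓ₀.1.le (by positivity) he
    fun ℓ hℓ => measure_biUnion_traversed_le hν hT hK hα₀ hα₁ (cutoff_le_of_mem_dyadicScales hδ hℓ)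
      (pos_of_mem_dyadicScales hδ hℓ) ((le_of_mem_dyadicScales hℓ).trans_lt hℓ₀.2)).trans
    (ENNReal.ofReal_le_ofReal hsmall))

end Probability

/-! ### Counting the cuts of a polygonal path -/

section Counting

variable {d : ℕ} {Λ : Set (EuclideanSpace ℝ (Fin d))} {C : Curve Λ} {F : Config Λ}
  {γ : ParamCurve Λ} {n k N : ℕ} {v : ℕ → EuclideanSpace ℝ (Fin d)} {r ℓ δ R : ℝ}

theorem exists_mem_crossedPoints (hCF : C ∈ F) (hC : Parametrizes γ C)
    (hf : RunsThrough (fun t => (γ.toMap t : EuclideanSpace ℝ (Fin d))) n v) (hn : 1 ≤ n)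
    (hR₀ : 0 < R) (hR : 4 * R ≤ Metric.diam (range γ.toMap))
    {T : Finset (EuclideanSpace ℝ (Fin d))} (hT : ∀ y ∈ Λ, ∃ x ∈ T, dist y x ≤ ℓ) {i : ℕ}
    (hi : i ≤ n) : ∃ x ∈ crossedPoints T F ℓ R, dist (v i) x ≤ ℓ := by
  rw [← hf.apply_vertexTime hn hi]
  obtain ⟨x, hx, hdist⟩ := hT _ (γ.toMap (vertexTime n i)).2
  exact ⟨x, mem_crossedPoints.2 ⟨hx, C, hCF, traversed_one_of_dist_le hC hR₀ hR hdist⟩, hdist⟩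

theorem card_cuts_le_mul_card_crossedPoints (hCF : C ∈ F) (hC : Parametrizes γ C)
    (hf : RunsThrough (fun t => (γ.toMap t : EuclideanSpace ℝ (Fin d))) n v) (hn : 1 ≤ n)
    (hR₀ : 0 < R) (hR : 4 * R ≤ Metric.diam (range γ.toMap))
    {T : Finset (EuclideanSpace ℝ (Fin d))} (hT : ∀ y ∈ Λ, ∃ x ∈ T, dist y x ≤ ℓ) {R' : ℝ}
    (hk : ∀ x ∈ T, ¬ ∃ C ∈ F, Traversed C k x ℓ R') (hr : R' + ℓ ≤ r) :
    (cuts v r n).card ≤ k * (crossedPoints T F ℓ R).card := by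
  classical
  rw [mul_comm, ← mul_one (cuts v r n).card]
  refine Finset.card_mul_le_card_mul (fun j x => dist (v (lastCut v r j)) x ≤ ℓ)
    (fun j hj => ?_) fun x hx => ?_
  · obtain ⟨x, hx, hdist⟩ := exists_mem_crossedPoints hCF hC hf hn hR₀ hR hT
      ((lastCut_le v r j).trans (mem_cuts.1 hj).1.le)
    exact Finset.card_pos.2 ⟨x, (Finset.mem_bipartiteAbove _).2 ⟨hx, hdist⟩⟩
  · by_contra! hlt
    exact hk x (mem_crossedPoints.1 hx).1 ⟨C, hCF, traversed_of_subset_cuts hC hf hn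
      (Finset.filter_subset _ _) hlt.le (fun j hj => ((Finset.mem_bipartiteBelow _).1 hj).2) hr⟩

theorem steps_le_mul_card_crossedPoints (hCF : C ∈ F) (hC : Parametrizes γ C)
    (hf : RunsThrough (fun t => (γ.toMap t : EuclideanSpace ℝ (Fin d))) n v) (hn : 1 ≤ n)
    (hR₀ : 0 < R) (hR : 4 * R ≤ Metric.diam (range γ.toMap))
    {T : Finset (EuclideanSpace ℝ (Fin d))} (hT : ∀ y ∈ Λ, ∃ x ∈ T, dist y x ≤ δ)
    (hN : ∀ x, {i : ℕ | i ≤ n ∧ dist (v i) x ≤ δ}.ncard ≤ N) :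
    n ≤ N * (crossedPoints T F δ R).card := by
  classical
  have hcard : (Finset.range (n + 1)).card * 1 ≤ (crossedPoints T F δ R).card * N := by
    refine Finset.card_mul_le_card_mul (fun i x => dist (v i) x ≤ δ) (fun i hi => ?_) fun x _ => ?_
    · obtain ⟨x, hx, hdist⟩ := exists_mem_crossedPoints hCF hC hf hn hR₀ hR hT
        (Finset.mem_range_succ_iff.1 hi)
      exact Finset.card_pos.2 ⟨x, (Finset.mem_bipartiteAbove _).2 ⟨hx, hdist⟩⟩
    · refine le_trans (le_of_eq ?_) (hN x)
      rw [← ncard_coe_finset]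
      congr 1
      ext i
      simp [Finset.bipartiteBelow]
  rw [Finset.card_range, mul_one, mul_comm] at hcard
  exact (Nat.le_succ n).trans hcard

theorem card_cuts_le_rpow_of_dyadicScales {X : Type*} [PseudoMetricSpace X] {v : ℕ → X}
    {M a α ℓ₀ : ℝ} (hδ : 0 < δ) (hℓ₀ : 0 ≤ ℓ₀) (hM : 0 ≤ M) (ha : 0 ≤ a) (hα : 0 < α)
    (hn : n ≤ M * δ ^ (-a))
    (hcuts : ∀ ℓ ∈ dyadicScales δ ℓ₀, 2 * ℓ ^ α ≤ r → (cuts v r n).card ≤ M * ℓ ^ (-a))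
    (hr : 0 < r) (hrℓ₀ : r ≤ 2 * ℓ₀ ^ α) :
    (cuts v r n).card ≤ M * 2 ^ (a + a / α) * r ^ (-(a / α)) := by
  set y := (r / 2) ^ (1 / α) with hy
  have hy₀ : 0 < y := by positivity
  suffices h : ∃ x, y / 2 ≤ x ∧ (cuts v r n).card ≤ M * x ^ (-a) by
    obtain ⟨x, hx, hcard⟩ := h
    calc ((cuts v r n).card : ℝ) ≤ M * x ^ (-a) := hcard
      _ ≤ M * (y / 2) ^ (-a) := by
        gcongr M * ?_
        exact Real.rpow_le_rpow_of_nonpos (by positivity) hx (by linarith)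
      _ = M * 2 ^ (a + a / α) * r ^ (-(a / α)) := by
        rw [hy, Real.div_rpow (by positivity) zero_le_two, ← Real.rpow_mul (by positivity),
          Real.div_rpow hr.le zero_le_two, Real.rpow_add two_pos, mul_neg, one_div_mul_eq_div,
          Real.rpow_neg zero_le_two, Real.rpow_neg zero_le_two]
        field_simp
  rcases lt_or_ge y δ with hyδ | hyδ
  · refine ⟨δ, by linarith, (Nat.cast_le.2 ?_).trans hn⟩
    exact (Finset.card_filter_le _ _).trans_eq (Finset.card_range n)
  · have hyα : y ^ α = r / 2 := by
      rw [hy, ← Real.rpow_mul (by positivity), one_div_mul_cancel hα.ne', Real.rpow_one]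
    have hyℓ₀ : y ≤ ℓ₀ := by
      rw [← Real.rpow_le_rpow_iff hy₀.le hℓ₀ hα, hyα]
      linarith
    obtain ⟨ℓ, hℓ, hℓy, hyℓ⟩ := exists_mem_dyadicScales hδ hyδ hyℓ₀
    refine ⟨ℓ, by linarith, hcuts ℓ hℓ ?_⟩
    linarith [Real.rpow_le_rpow (pos_of_mem_dyadicScales hδ hℓ).le hℓy hα.le]

end Counting

/-! ### Hölder continuous parametrizations -/

section Regularity

variable {d : ℕ} {Λ : Set (EuclideanSpace ℝ (Fin d))} {C : Curve Λ} {F : Config Λ}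
  {γ : ParamCurve Λ} {n k N : ℕ} {v : ℕ → EuclideanSpace ℝ (Fin d)} {δ R a l u α ℓ₀ s B : ℝ}
  {T : ℝ → Finset (EuclideanSpace ℝ (Fin d))}

theorem parametrizes_reparam {X : Type*} [PseudoMetricSpace X] {γ : ParamCurve X} {C : Curve X}
    (h : Parametrizes γ C) (φ : I ≃ₜ I) : Parametrizes ⟨γ.reparam φ⟩ C := by
  rw [Parametrizes] at h ⊢
  rw [← h, SeparationQuotient.mk_eq_mk, Metric.inseparable_iff]
  exact le_antisymm ((curveDist_le _ _ (Homeomorph.refl I) φ).trans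
    (dist_self (γ.reparam φ)).le) dist_nonneg

theorem steps_le_rpow (hT : IsNetFamily Λ B T) (hCF : C ∈ F) (hC : Parametrizes γ C)
    (hf : RunsThrough (fun t => (γ.toMap t : EuclideanSpace ℝ (Fin d))) n v) (hn : 1 ≤ n)
    (hN : ∀ x, {i : ℕ | i ≤ n ∧ dist (v i) x ≤ δ}.ncard ≤ N) (hδ : δ ∈ Ioc (0 : ℝ) 1)
    (hfew : FewCrossings T δ a l u F) (hR : R ∈ Ioc (0 : ℝ) 1)
    (hdiam : 4 * R ≤ Metric.diam (range γ.toMap)) :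
    n ≤ N * (u * R ^ (-l)) * δ ^ (-a) := by
  have hmem : δ ∈ dyadicScales δ 1 := (mem_dyadicScales hδ.1).2 ⟨⟨0, by simp⟩, hδ.2⟩
  calc (n : ℝ) ≤ N * (crossedPoints (T δ) F δ R).card := by
        exact_mod_cast steps_le_mul_card_crossedPoints hCF hC hf hn hR.1 hdiam (hT δ hδ).2 hN
    _ ≤ N * (u * δ ^ (-a) * R ^ (-l)) := by
        gcongr
        exact hfew δ hmem R hR
    _ = N * (u * R ^ (-l)) * δ ^ (-a) := by ring

theorem card_cuts_le_rpow (hT : IsNetFamily Λ B T) (hCF : C ∈ F) (hC : Parametrizes γ C)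
    (hf : RunsThrough (fun t => (γ.toMap t : EuclideanSpace ℝ (Fin d))) n v) (hn : 1 ≤ n)
    (hδ : 0 < δ) (hα : α ≤ 1) (hℓ₀ : ℓ₀ ≤ 1) (hfew : FewCrossings T δ a l u F)
    (hno : NoMultipleCrossing T δ α k ℓ₀ F) (hR : R ∈ Ioc (0 : ℝ) 1)
    (hdiam : 4 * R ≤ Metric.diam (range γ.toMap)) {ℓ r : ℝ} (hℓ : ℓ ∈ dyadicScales δ ℓ₀)
    (hr : 2 * ℓ ^ α ≤ r) : (cuts v r n).card ≤ k * (u * R ^ (-l)) * ℓ ^ (-a) := by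
  have hℓ₁ : ℓ ∈ Ioc (0 : ℝ) 1 :=
    ⟨pos_of_mem_dyadicScales hδ hℓ, (le_of_mem_dyadicScales hℓ).trans hℓ₀⟩
  have hℓα : ℓ ≤ ℓ ^ α := Real.self_le_rpow_of_le_one hℓ₁.1.le hℓ₁.2 hα
  calc ((cuts v r n).card : ℝ) ≤ k * (crossedPoints (T ℓ) F ℓ R).card := by
        exact_mod_cast card_cuts_le_mul_card_crossedPoints hCF hC hf hn hR.1 hdiam (hT ℓ hℓ₁).2
          (hno ℓ hℓ) (by linarith)
    _ ≤ k * (u * ℓ ^ (-a) * R ^ (-l)) := by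
        gcongr
        exact hfew ℓ ((mem_dyadicScales hδ).2 ⟨((mem_dyadicScales hδ).1 hℓ).1, hℓ₁.2⟩) R hR
    _ = k * (u * R ^ (-l)) * ℓ ^ (-a) := by ring

theorem steps_le_rpow_and_card_cuts_le_rpow (hT : IsNetFamily Λ B T) (hCF : C ∈ F)
    (hC : Parametrizes γ C)
    (hf : RunsThrough (fun t => (γ.toMap t : EuclideanSpace ℝ (Fin d))) n v) (hn : 1 ≤ n)
    (hN : ∀ x, {i : ℕ | i ≤ n ∧ dist (v i) x ≤ δ}.ncard ≤ N) (hδ : δ ∈ Ioc (0 : ℝ) 1)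
    (hα : α ∈ Ioc (0 : ℝ) 1) (hℓ₀ : ℓ₀ ∈ Ioc (0 : ℝ) 1) (ha : 0 ≤ a) (hu : 0 ≤ u)
    (hfew : FewCrossings T δ a l u F) (hno : NoMultipleCrossing T δ α k ℓ₀ F)
    (hR : R ∈ Ioc (0 : ℝ) 1) (hdiam : 4 * R ≤ Metric.diam (range γ.toMap)) :
    n ≤ max N k * (u * R ^ (-l)) * 2 ^ (a + a / α) * δ ^ (-(a / α)) ∧
      ∀ r ∈ dyadicScales δ (2 * ℓ₀ ^ α),
        (cuts v r n).card ≤ max N k * (u * R ^ (-l)) * 2 ^ (a + a / α) * r ^ (-(a / α)) := by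
  obtain ⟨hα₀, hα₁⟩ := hα
  have hδ₀ := hδ.1
  have hR₀ := hR.1
  set A := ((max N k : ℕ) : ℝ) * (u * R ^ (-l)) with hA
  have hsteps : n ≤ A * δ ^ (-a) := (steps_le_rpow hT hCF hC hf hn hN hδ hfew hR hdiam).trans <| by
    rw [hA]
    gcongr
    exact le_max_left N k
  refine ⟨hsteps.trans (mul_le_mul ?_ ?_ (by positivity) (by positivity)), fun r hr =>
    card_cuts_le_rpow_of_dyadicScales hδ₀ hℓ₀.1.le (by positivity) ha hα₀ hsteps
      (fun ℓ hℓ hℓr => ?_) (pos_of_mem_dyadicScales hδ₀ hr) (le_of_mem_dyadicScales hr)⟩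
  · exact le_mul_of_one_le_right (a := A) (by positivity)
      (Real.one_le_rpow one_le_two (by positivity))
  · exact Real.rpow_le_rpow_of_exponent_ge hδ₀ hδ.2 (neg_le_neg (le_div_self ha hα₀ hα₁))
  · have hℓ_pos := pos_of_mem_dyadicScales hδ₀ hℓ
    refine (card_cuts_le_rpow hT hCF hC hf hn hδ₀ hα₁ hℓ₀.2 hfew hno hR hdiam hℓ hℓr).trans ?_
    rw [hA]
    gcongr
    exact le_max_right N k

theorem exists_parametrizes_rpow_dist_le (hT : IsNetFamily Λ B T)
    (hα : α ∈ Ioc (0 : ℝ) 1) (ha : 0 ≤ a) (haα : a < α * s) (hs : 1 ≤ s) (hu : 0 ≤ u)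
    (hℓ₀ : ℓ₀ ∈ Ioc (0 : ℝ) 1) {D : ℝ} (hD : ∀ x ∈ Λ, ∀ y ∈ Λ, dist x y ≤ D) :
    ∃ M ≥ 0, ∀ δ ∈ Ioc (0 : ℝ) 1, ∀ F : Config Λ, FewCrossings T δ a l u F →
      NoMultipleCrossing T δ α k ℓ₀ F → ∀ C ∈ F, ∀ γ n v, Parametrizes γ C → 1 ≤ n →
      (∀ i < n, dist (v i) (v (i + 1)) ≤ δ) →
      RunsThrough (fun t => (γ.toMap t : EuclideanSpace ℝ (Fin d))) n v →
      (∀ x, {i : ℕ | i ≤ n ∧ dist (v i) x ≤ δ}.ncard ≤ N) →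
      ∀ R ∈ Ioc (0 : ℝ) 1, 4 * R ≤ Metric.diam (range γ.toMap) →
      ∃ γ' : ParamCurve Λ, Parametrizes γ' C ∧ range γ'.toMap = range γ.toMap ∧
        ∀ t₁ t₂ : I, t₁ ≤ t₂ →
          dist (γ'.toMap t₁) (γ'.toMap t₂) ^ s ≤ M * R ^ (-l) * ((t₂ : ℝ) - t₁) := by
  have hℓ₀_pos := hℓ₀.1
  set r₀ := 2 * ℓ₀ ^ α
  have hr₀ : 0 < r₀ := by positivity
  set c := max 5 (D / r₀)
  have hc : 5 ≤ c := le_max_left _ _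
  have hb : a / α < s := (div_lt_iff₀' hα.1).2 haα
  set S := r₀ ^ (s - a / α) / (1 - 2 ^ (-(s - a / α)))
  have hS : 0 ≤ S := div_nonneg (by positivity) (one_sub_two_rpow_neg_pos (sub_pos.2 hb)).le
  refine ⟨(2 * c) ^ s * (1 + 2 * S) * (max N k * u * 2 ^ (a + a / α)), by positivity,
    fun δ hδ F hfew hno C hCF γ n v hC hn hv hf hN R hR hdiam => ?_⟩
  obtain ⟨hsteps, hcuts⟩ := steps_le_rpow_and_card_cuts_le_rpow hT hCF hC hf hn hN hδ hα hℓ₀ ha hu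
    hfew hno hR hdiam
  obtain ⟨ψ, hψ⟩ := hf.exists_orderIso_rpow_dist_le hn hv hδ.1 hδ.2 hs hb hr₀ hsteps hcuts hc
    fun t₁ t₂ => (hD _ (γ.toMap t₁).2 _ (γ.toMap t₂).2).trans
      ((div_le_iff₀ hr₀).1 (le_max_right _ _))
  refine ⟨⟨γ.reparam ψ.symm.toHomeomorph⟩, parametrizes_reparam hC _,
    ψ.symm.surjective.range_comp _, fun t₁ t₂ ht => ?_⟩
  have hdist := hψ (ψ.symm t₁) (ψ.symm t₂) (ψ.symm.monotone ht)
  rw [ψ.apply_symm_apply, ψ.apply_symm_apply] at hdist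
  exact hdist.trans_eq (by ring)

theorem le_rpow_mul_of_rpow_le {ρ M L c Δ p : ℝ} (hs : 0 < s) (hρ : 0 ≤ ρ) (hM : 0 ≤ M)
    (hΔ : 0 ≤ Δ) (hL : L ∈ Ioc 0 c) (hp : l ≤ p * s) (h : ρ ^ s ≤ M * (L / c) ^ (-l) * Δ) :
    ρ ≤ M ^ (1 / s) * c ^ p * L ^ (-p) * Δ ^ (1 / s) := by
  have hc : 0 < c := hL.1.trans_le hL.2
  have hR : 0 < L / c := div_pos hL.1 hc
  calc ρ = (ρ ^ s) ^ (1 / s) := by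
        rw [← Real.rpow_mul hρ, mul_one_div_cancel hs.ne', Real.rpow_one]
    _ ≤ (M * (L / c) ^ (-p * s) * Δ) ^ (1 / s) := by
        gcongr
        refine h.trans ?_
        gcongr M * ?_ * Δ
        exact Real.rpow_le_rpow_of_exponent_ge hR ((div_le_one hc).2 hL.2) (by linarith)
    _ = M ^ (1 / s) * (L / c) ^ (-p) * Δ ^ (1 / s) := by
        rw [Real.mul_rpow (by positivity) hΔ, Real.mul_rpow hM (by positivity),
          ← Real.rpow_mul hR.le, mul_assoc (-p), mul_one_div_cancel hs.ne', mul_one]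
    _ = M ^ (1 / s) * c ^ p * L ^ (-p) * Δ ^ (1 / s) := by
        rw [Real.div_rpow hL.1.le hc.le, Real.rpow_neg hc.le, div_inv_eq_mul]
        ring

/-- Every curve of `F` has a parametrization which is Hölder continuous of order `1 / s`, with
constant `κ` up to a power of the diameter of the curve. -/
def HasHolderParametrizations (F : Config Λ) (κ p s : ℝ) : Prop :=
  ∀ C ∈ F, ∃ γ : ParamCurve Λ, Parametrizes γ C ∧ ∀ t₁ t₂ : I, t₁ < t₂ →
    dist (γ.toMap t₁) (γ.toMap t₂) ≤
      κ * Metric.diam (range γ.toMap) ^ (-p) * ((t₂ : ℝ) - t₁) ^ (1 / s)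

theorem dist_le_diam_range (γ : ParamCurve Λ) (t₁ t₂ : I) :
    dist (γ.toMap t₁) (γ.toMap t₂) ≤ Metric.diam (range γ.toMap) :=
  Metric.dist_le_diam_of_mem (isCompact_range γ.toMap.continuous).isBounded
    (mem_range_self t₁) (mem_range_self t₂)

theorem exists_hasHolderParametrizations (hT : IsNetFamily Λ B T) (hΛ : Bornology.IsBounded Λ)
    (hα : α ∈ Ioc (0 : ℝ) 1) (ha : 0 ≤ a) (haα : a < α * s) (hs : 1 ≤ s) (hu : 0 ≤ u)
    (hℓ₀ : ℓ₀ ∈ Ioc (0 : ℝ) 1) {p : ℝ} (hp : l ≤ p * s) :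
    ∃ κ : ℕ, ∀ δ ∈ Ioc (0 : ℝ) 1, ∀ F : Config Λ, FewCrossings T δ a l u F →
      NoMultipleCrossing T δ α k ℓ₀ F → (∀ C ∈ F, IsPolygonal δ N C) →
      HasHolderParametrizations F κ p s := by
  obtain ⟨D, hD⟩ : ∃ D, ∀ x ∈ Λ, ∀ y ∈ Λ, dist x y ≤ D :=
    (Metric.isBounded_iff.1 hΛ).imp fun D hD x hx y hy => hD hx hy
  obtain ⟨M, hM, hM_dist⟩ := exists_parametrizes_rpow_dist_le (k := k) (N := N) (l := l)
    hT hα ha haα hs hu hℓ₀ hD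
  set c := max 4 D
  have hc : 0 < c := four_pos.trans_le (le_max_left _ _)
  refine ⟨⌈M ^ (1 / s) * c ^ p⌉₊, fun δ hδ F hfew hno hpoly C hCF => ?_⟩
  obtain ⟨γ, n, v, hC, hn, hv, hf, hN⟩ := hpoly C hCF
  set L := Metric.diam (range γ.toMap)
  rcases (Metric.diam_nonneg : 0 ≤ L).eq_or_lt with hL₀ | hL₀
  · refine ⟨γ, hC, fun t₁ t₂ ht => ((dist_le_diam_range γ t₁ t₂).trans_eq hL₀.symm).trans ?_⟩
    have hΔ : 0 ≤ (t₂ : ℝ) - t₁ := sub_nonneg.2 ht.le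
    positivity
  have hLc : L ≤ c := Metric.diam_le_of_forall_dist_le hc.le <| by
    rintro _ ⟨t₁, rfl⟩ _ ⟨t₂, rfl⟩
    exact (hD _ (γ.toMap t₁).2 _ (γ.toMap t₂).2).trans (le_max_right _ _)
  have hR : 4 * (L / c) ≤ L := by
    rw [← mul_div_assoc, div_le_iff₀' hc]
    exact mul_le_mul_of_nonneg_right (le_max_left _ _) hL₀.le
  obtain ⟨γ', hC', hrange, hγ'⟩ := hM_dist δ hδ F hfew hno C hCF γ n v hC hn hv hf hN (L / c)
    ⟨div_pos hL₀ hc, (div_le_one hc).2 hLc⟩ hR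
  refine ⟨γ', hC', fun t₁ t₂ ht => ?_⟩
  have hΔ : 0 ≤ (t₂ : ℝ) - t₁ := sub_nonneg.2 ht.le
  refine (le_rpow_mul_of_rpow_le (one_pos.trans_le hs) dist_nonneg hM hΔ ⟨hL₀, hLc⟩ hp
    (hγ' t₁ t₂ ht.le)).trans ?_
  rw [hrange]
  gcongr
  exact Nat.le_ceil _

theorem exists_exponents {d l ε lk : ℝ} (hd : 0 ≤ d) (hld : l ≤ d) (hε : 0 < ε)
    (hlk : d * (d - l + ε) < ε * lk) :
    ∃ α ∈ Ioo (0 : ℝ) 1, d < (1 - α) * lk ∧ ∃ a, d - l < a ∧ a < α * (d - l + ε) := by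
  have hs : 0 < d - l + ε := by linarith
  have hlk₀ : 0 < lk := pos_of_mul_pos_right ((mul_nonneg hd hs.le).trans_lt hlk) hε.le
  obtain ⟨β, hβ, hβε⟩ : ∃ β, d / lk < β ∧ β < ε / (d - l + ε) :=
    exists_between ((div_lt_div_iff₀ hlk₀ hs).2 hlk)
  have hβ₀ : 0 < β := (div_nonneg hd hlk₀.le).trans_lt hβ
  have hβ₁ : β < 1 := hβε.trans_le ((div_le_one hs).2 (by linarith))
  rw [div_lt_iff₀ hlk₀] at hβ
  rw [lt_div_iff₀ hs] at hβε
  exact ⟨1 - β, ⟨by linarith, by linarith⟩, by rwa [sub_sub_cancel], exists_between (by linarith)⟩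

theorem le_div_sub_mul_mul {d l ε : ℝ} (hl₀ : 0 ≤ l) (hld : l < d) (hε : 0 ≤ ε) :
    l ≤ l / (d - l) * (1 + ε) * (d - l + ε) := by
  have hdl : 0 < d - l := sub_pos.2 hld
  rw [div_mul_eq_mul_div, div_mul_eq_mul_div, le_div_iff₀ hdl, mul_assoc]
  gcongr
  nlinarith [mul_nonneg hε hdl.le]

theorem exists_measure_not_hasHolderParametrizations_le (hΛ : Bornology.IsBounded Λ)
    {K₁ Kk lk ε p η : ℝ} (hl₀ : 0 ≤ l) (hld : l ≤ d) (hε : 0 < ε) (hs : 1 ≤ d - l + ε)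
    (hlk : d * (d - l + ε) < ε * lk) (hp : l ≤ p * (d - l + ε)) (hη : 0 < η) :
    ∃ κ : ℕ, ∀ δ ∈ Ioc (0 : ℝ) 1, ∀ ν : Measure (Config Λ),
      HasCrossingBound ν δ 1 K₁ l → HasCrossingBound ν δ k Kk lk →
      ν {F | ¬ ((∀ C ∈ F, IsPolygonal δ N C) → HasHolderParametrizations F κ p (d - l + ε))} ≤
        ENNReal.ofReal η := by
  obtain ⟨B, T, hB, hT⟩ := exists_isNetFamily hΛ
  obtain ⟨α, hα, hαlk, a, ha, haα⟩ := exists_exponents d.cast_nonneg hld hε hlk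
  obtain ⟨u, hu, hfew⟩ := exists_measure_not_fewCrossings_le hT hB (abs_nonneg K₁) hl₀ ha
    (half_pos hη)
  obtain ⟨ℓ₀, hℓ₀, hno⟩ := exists_measure_not_noMultipleCrossing_le (k := k) hT hB.le
    (abs_nonneg Kk) hα.1.le hα.2 hαlk (half_pos hη)
  obtain ⟨κ, hκ⟩ := exists_hasHolderParametrizations (k := k) (N := N) hT hΛ
    (Ioo_subset_Ioc_self hα) ((sub_nonneg.2 hld).trans ha.le) haα hs hu.le
    (Ioo_subset_Ioc_self hℓ₀) hp
  refine ⟨κ, fun δ hδ ν h₁ hk => ?_⟩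
  calc ν {F | ¬ ((∀ C ∈ F, IsPolygonal δ N C) → HasHolderParametrizations F κ p (d - l + ε))}
      ≤ ν ({F | ¬ FewCrossings T δ a l u F} ∪ {F | ¬ NoMultipleCrossing T δ α k ℓ₀ F}) :=
        measure_mono fun F hF => by
          by_contra hgood
          simp only [mem_union, mem_ofPred_eq, not_or, not_not] at hgood
          exact hF (hκ δ hδ F hgood.1 hgood.2)
    _ ≤ ENNReal.ofReal (η / 2) + ENNReal.ofReal (η / 2) := (measure_union_le _ _).trans
        (add_le_add (hfew δ hδ.1 ν (h₁.abs hδ.1)) (hno δ hδ.1 ν (hk.abs hδ.1)))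
    _ = ENNReal.ofReal η := by
        rw [← ENNReal.ofReal_add (half_pos hη).le (half_pos hη).le, add_halves]

end Regularity

end RandomCurves

theorem mainTheorem1_general {d : ℕ} {Λ : Set (EuclideanSpace ℝ (Fin d))}
    (hΛ : Bornology.IsBounded Λ) {δmax : ℝ} (hδ1 : δmax ≤ 1) {μ : ℝ → Measure (Config Λ)} {N k : ℕ}
    (hN : ∀ δ ∈ Ioc 0 δmax, ∀ᵐ F ∂(μ δ), ∀ C ∈ F, IsPolygonal δ N C) {K₁ l Kk lk ε p : ℝ}
    (h₁ : ∀ δ ∈ Ioc 0 δmax, HasCrossingBound (μ δ) δ 1 K₁ l)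
    (hk : ∀ δ ∈ Ioc 0 δmax, HasCrossingBound (μ δ) δ k Kk lk) (hl₀ : 0 ≤ l) (hld : l ≤ d)
    (hε : 0 < ε) (hs : 1 ≤ d - l + ε) (hlk : d * (d - l + ε) < ε * lk)
    (hp : l ≤ p * (d - l + ε)) :
    ∃ κ : ℝ → Config Λ → ℝ,
      (∀ δ ∈ Ioc 0 δmax, Measurable (κ δ)) ∧
      StochasticallyBounded δmax μ κ ∧
      ∀ δ ∈ Ioc 0 δmax, ∀ᵐ F ∂(μ δ), HasHolderParametrizations F (κ δ F) p (d - l + ε) := by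
  obtain ⟨κ, hκm, hκb, hκ⟩ := exists_stochasticallyBounded (μ := μ) (δmax := δmax)
    (fun δ u => {F | ¬ ((∀ C ∈ F, IsPolygonal δ N C) →
      HasHolderParametrizations F u p (d - l + ε))}) fun η hη => by
    obtain ⟨u, hu⟩ := exists_measure_not_hasHolderParametrizations_le (Λ := Λ) (k := k) (N := N)
      (K₁ := K₁) (Kk := Kk) hΛ hl₀ hld hε hs hlk hp hη
    exact ⟨u, fun δ hδ => hu δ ⟨hδ.1, hδ.2.trans hδ1⟩ (μ δ) (h₁ δ hδ) (hk δ hδ)⟩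
  refine ⟨κ, hκm, hκb, fun δ hδ => ?_⟩
  filter_upwards [hκ δ hδ, hN δ hδ] with F hF hpoly
  obtain ⟨u, hu, hgood⟩ := hF
  rw [hu]
  exact not_not.1 hgood hpoly

/-- Regularity of random curves: Hölder continuous parametrizations, simultaneously for all curves
of the configuration, with a common stochastically bounded prefactor. -/
theorem mainTheorem1 (d : ℕ) (Λ : Set (EuclideanSpace ℝ (Fin d))) (hΛ : IsCompact Λ)
    (δmax : ℝ) (hδ0 : 0 < δmax) (hδ1 : δmax ≤ 1)
    (μ : ℝ → Measure (Config Λ)) (hμ : IsSystem δmax μ)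
    (K lam : ℕ → ℝ) (hH1 : HypothesisH1 δmax μ K lam)
    (hlam0 : 0 ≤ lam 1) (hlamd : lam 1 < d)
    (ε : ℝ) (hε : 0 < ε) (hεd : 1 ≤ d - lam 1 + ε) :
    ∃ κ : ℝ → Config Λ → ℝ,
      (∀ δ ∈ Ioc 0 δmax, Measurable (κ δ)) ∧
      StochasticallyBounded δmax μ κ ∧
      ∀ δ ∈ Ioc 0 δmax, ∀ᵐ F ∂(μ δ), ∀ C ∈ F,
        ∃ γ : ParamCurve Λ, Parametrizes γ C ∧
          ∀ t₁ t₂ : I, t₁ < t₂ →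
            dist (γ.toMap t₁) (γ.toMap t₂) ≤
              κ δ F * (Metric.diam (range γ.toMap) ^ (-(lam 1 / (d - lam 1)))) ^ (1 + ε)
                * ((t₂ : ℝ) - t₁) ^ (1 / (d - lam 1 + ε)) := by
  obtain ⟨-, N, hN⟩ := hμ
  obtain ⟨h, hlam⟩ := hH1
  obtain ⟨k, hk, hk₁⟩ : ∃ k, d * (d - lam 1 + ε) / ε < lam k ∧ 1 ≤ k :=
    ((hlam.eventually_gt_atTop _).and (eventually_ge_atTop 1)).exists
  simp only [← Real.rpow_mul Metric.diam_nonneg, neg_mul]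
  exact mainTheorem1_general hΛ.isBounded hδ1 hN (h 1 le_rfl) (h k hk₁) hlam0 hlamd.le hε hεd
    ((div_lt_iff₀' hε).1 hk) (le_div_sub_mul_mul hlam0 hlamd hε.le)
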